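/- Let $\mathbb T\subset\mathbb R$ be an interval (finite or infinite), let $\Theta\subset\mathbb R^d$ be open, convex and bounded, and for $\vartheta\in\Theta$ let $\lambda(\vartheta,\cdot):\mathbb T\to(0,\infty)$ be an intensity function with $\int_{\mathbb T}\lambda(\vartheta,t)\,dt<\infty$. Fix $\vartheta_0\in\Theta$, and let $X_1,X_2,\ldots$ be independent Poisson processes on $\mathbb T$ with intensity function $\lambda(\vartheta_0,\cdot)$, i.e. counting processes whose increments over disjoint intervals are independent and whose increment over $(s,t]$ is Poisson distributed with mean $\int_s^t\lambda(\vartheta_0,u)\,du$. Write $\dot\lambda$ for the gradient of $\lambda$ in $\vartheta$ and $$\mathbf I(\vartheta)=\int_{\mathbb T}\dot\lambda(\vartheta,t)\dot\lambda(\vartheta,t)^{\top}\lambda(\vartheta,t)^{-1}\,dt$$ for the Fisher information matrix. Assume: ($\mathcal P_0$) For every $n$, $\bar\vartheta_n$ is an ($\mathbb R^d$-valued) estimator based on $X_1,\ldots,X_n$; the sequence $\bar\vartheta_n$ is consistent, and $\sqrt n(\bar\vartheta_n-\vartheta_0)$ is bounded in probability. ($\mathcal L_0$) For every $t\in\mathbb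 T$ the function $\vartheta\mapsto\ln\lambda(\vartheta,t)$ is three times continuously differentiable on $\Theta$, its derivatives of orders $1,2,3$ are bounded on $\Theta\times\mathbb T$, and $\inf_{\vartheta\in\Theta}\inf_{|\mu|=1}\mu^{\top}\mathbf I(\vartheta)\mu>0$. Let $\delta\in(\tfrac12,1)$, $N=[n^{\delta}]$, and define the one-step MLE by $$\vartheta_n^\star=\bar\vartheta_N+\frac{\mathbf I(\bar\vartheta_N)^{-1}}{n}\sum_{j=N+1}^{n}\int_{\mathbb T}\frac{\dot\lambda(\bar\vartheta_N,t)}{\lambda(\bar\vartheta_N,t)}\bigl[dX_j(t)-\lambda(\bar\vartheta_N,t)\,dt\bigr]$$ if $\bar\vartheta_N\in\Theta$, and $\vartheta_n^\star=\bar\vartheta_N$ otherwise. Then, as $n\to\infty$, $$\sqrt n\,(\vartheta_n^\star-\vartheta_0)\Longrightarrow\mathcal N\bigl(0,\mathbf I(\vartheta_0)^{-1}\bigr).$$ -/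

import Mathlib

open MeasureTheory ProbabilityTheory Filter Topology Set

noncomputable section

namespace PoissonOneStep

/-- A (inhomogeneous) Poisson process on the interval `T` with intensity function `lam`.
The counting process `X(t)` is given by its jump measure `X ω`, a random measure carried by `T`:
`X(t) = X ω (T ∩ (-∞, t])`, the increment over `(s, t]` is `X ω (T ∩ (s, t])`, and
`∫_T f(t) dX(t)` is the integral of `f` against `X ω`.
Increments over disjoint intervals are independent, and the increment over `(s, t]` is Poisson
distributed with mean `∫_{T ∩ (s, t]} lam`. Since `s` may lie to the left of `T`, a jump at a left
endpoint of `T` is also governed by this law (it has probability zero). -/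
structure IsPoissonProcess {Ω : Type*} [MeasurableSpace Ω] (P : Measure Ω) (T : Set ℝ)
    (lam : ℝ → ℝ) (X : Ω → Measure ℝ) : Prop where
  measurable : Measurable X
  carried : ∀ ω, X ω Tᶜ = 0
  increment_law : ∀ s t : ℝ, s < t → ∀ k : ℕ,
    P {ω | X ω (T ∩ Ioc s t) = k} =
      ENNReal.ofReal (Real.exp (-∫ u in T ∩ Ioc s t, lam u) *
        (∫ u in T ∩ Ioc s t, lam u) ^ k / (k.factorial : ℝ))
  indep_increments : ∀ t : ℕ → ℝ, Monotone t →
    iIndepFun (fun (i : ℕ) (ω : Ω) => X ω (T ∩ Ioc (t i) (t (i + 1)))) P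

/-- The vector `λ̇(ϑ, t)` of the first derivatives of the intensity with respect to `ϑ`. -/
def intensityGrad {d : ℕ} (lam : EuclideanSpace ℝ (Fin d) → ℝ → ℝ)
    (θ : EuclideanSpace ℝ (Fin d)) (t : ℝ) : EuclideanSpace ℝ (Fin d) :=
  gradient (fun η => lam η t) θ

/-- The Fisher information matrix `I(ϑ) = ∫_T λ̇(ϑ, t) λ̇(ϑ, t)ᵀ λ(ϑ, t)⁻¹ dt`. -/
def fisherInfo {d : ℕ} (T : Set ℝ) (lam : EuclideanSpace ℝ (Fin d) → ℝ → ℝ)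
    (θ : EuclideanSpace ℝ (Fin d)) : Matrix (Fin d) (Fin d) ℝ :=
  Matrix.of fun i j =>
    ∫ t in T, intensityGrad lam θ t i * intensityGrad lam θ t j * (lam θ t)⁻¹

/-- The score `∫_T λ̇(ϑ, t) λ(ϑ, t)⁻¹ [dx(t) - λ(ϑ, t) dt]` of one observation `x`. -/
def score {d : ℕ} (T : Set ℝ) (lam : EuclideanSpace ℝ (Fin d) → ℝ → ℝ)
    (θ : EuclideanSpace ℝ (Fin d)) (x : Measure ℝ) : EuclideanSpace ℝ (Fin d) :=
  (∫ t in T, (lam θ t)⁻¹ • intensityGrad lam θ t ∂x) -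
    ∫ t in T, lam θ t • ((lam θ t)⁻¹ • intensityGrad lam θ t)

/-- The number `N = [n ^ δ]` of learning observations. -/
def learningSize (δ : ℝ) (n : ℕ) : ℕ := ⌊(n : ℝ) ^ δ⌋₊

/-- The value at the observations `x 0, x 1, …` of an estimator based on the first `n` of them. -/
def evalFirst {d : ℕ} (est : (n : ℕ) → (Fin n → Measure ℝ) → EuclideanSpace ℝ (Fin d))
    (n : ℕ) (x : ℕ → Measure ℝ) : EuclideanSpace ℝ (Fin d) :=
  est n fun j => x j

open Classical in
/-- The one-step MLE
`ϑ̄_N + n⁻¹ I(ϑ̄_N)⁻¹ ∑_{j = N+1}^n ∫_T λ̇(ϑ̄_N, t) λ(ϑ̄_N, t)⁻¹ [dX_j(t) - λ(ϑ̄_N, t) dt]`,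
where `ϑ̄_N` is the preliminary estimator based on the first `N = [n ^ δ]` observations. The
observations are numbered from `0`, so the sum runs over the indices `N, …, n - 1`. The correction
only makes sense if `ϑ̄_N ∈ Θ`; otherwise `ϑ̄_N` is left as it is. -/
def oneStepMLE {d : ℕ} (T : Set ℝ) (Θ : Set (EuclideanSpace ℝ (Fin d)))
    (lam : EuclideanSpace ℝ (Fin d) → ℝ → ℝ) (δ : ℝ)
    (est : (n : ℕ) → (Fin n → Measure ℝ) → EuclideanSpace ℝ (Fin d))
    (n : ℕ) (x : ℕ → Measure ℝ) : EuclideanSpace ℝ (Fin d) :=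
  let N := learningSize δ n
  let θ := evalFirst est N x
  if θ ∈ Θ then
    θ + (n : ℝ)⁻¹ •
      Matrix.toEuclideanLin (fisherInfo T lam θ)⁻¹ (∑ j ∈ Finset.Ico N n, score T lam θ (x j))
  else θ

/-- The preliminary estimator is consistent, and `√n (ϑ̄_n - ϑ₀)` is bounded in probability. -/
structure ConditionP0 {Ω : Type*} [MeasurableSpace Ω] (P : Measure Ω) {d : ℕ}
    (θ₀ : EuclideanSpace ℝ (Fin d)) (X : ℕ → Ω → Measure ℝ)
    (est : (n : ℕ) → (Fin n → Measure ℝ) → EuclideanSpace ℝ (Fin d)) : Prop where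
  consistent : TendstoInMeasure P (fun n ω => evalFirst est n fun j => X j ω) atTop fun _ => θ₀
  bounded_in_prob : ∀ ε : ℝ, 0 < ε → ∃ M : ℝ, ∀ n : ℕ,
    P {ω | M < ‖√(n : ℝ) • (evalFirst est n (fun j => X j ω) - θ₀)‖} ≤ ENNReal.ofReal ε

/-- `ln λ(ϑ, t)` has three continuous derivatives with respect to `ϑ`, bounded on `Θ × T`, and the
Fisher information matrix is uniformly nondegenerate on `Θ`. -/
structure ConditionL0 {d : ℕ} (T : Set ℝ) (Θ : Set (EuclideanSpace ℝ (Fin d)))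
    (lam : EuclideanSpace ℝ (Fin d) → ℝ → ℝ) : Prop where
  pos : ∀ θ ∈ Θ, ∀ t ∈ T, 0 < lam θ t
  contDiffOn : ∀ t ∈ T, ContDiffOn ℝ 3 (fun θ => Real.log (lam θ t)) Θ
  bounded : ∃ C : ℝ, ∀ k ∈ Finset.Icc 1 3, ∀ θ ∈ Θ, ∀ t ∈ T,
    ‖iteratedFDeriv ℝ k (fun η => Real.log (lam η t)) θ‖ ≤ C
  nondegenerate : ∃ c : ℝ, 0 < c ∧ ∀ θ ∈ Θ, ∀ μ : EuclideanSpace ℝ (Fin d), ‖μ‖ = 1 →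
    c ≤ inner ℝ μ (Matrix.toEuclideanLin (fisherInfo T lam θ) μ)

end PoissonOneStep

end

open PoissonOneStep

/-! The correction cancels the error of the preliminary estimator to first order. Write `f_θ =
I(θ)⁻¹ λ̇(θ,·)/λ(θ,·)`, `U` for the preliminary estimator from `N` observations, and `Λ` for the
intensity measure at `θ₀`. When `U ∈ Θ`, each summand of the correction is the compensated integral
`∫ f_U (dX_j - dΛ)` plus the bias `∫ f_U (λ(θ₀) - λ(U)) dt`. Expanding the intensity at `U`, the
linear part of the bias is `I(U)⁻¹ I(U) (θ₀ - U) = θ₀ - U`, and the remainder is `O(‖U - θ₀‖²)`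
(`norm_bias_le`). After multiplication by `√n` the biases and `U - θ₀` leave terms of size `√(N/n)
W` and `(√n/N) W²`, where `W = √N ‖U - θ₀‖` is bounded in probability. The first vanishes because `δ
< 1`, the second because `δ > 1/2`.

The observations used in the correction are independent of `U`. Hence replacing `f_U` by `f_θ₀` in
the compensated integrals costs, in second moment, at most twice the mean of `∫ ‖f_U - f_θ₀‖² dΛ`,
which tends to `0` by consistency (`lintegral_norm_sq_sum_compensatedIntegral_param_le`). Adding the
absent first `N` terms costs a second moment of order `N/n`. There remains a normalized sum of
independent variables `∫ f_θ₀ (dX_j - dΛ)`, whose covariance is `I⁻¹ I I⁻¹ = I⁻¹` at `θ₀`.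

The central limit theorem (`tendstoInDistribution_sum_compensatedIntegral`) and the moment bounds
both follow from the characteristic functional `E exp(i ∫ f dX) = exp ∫ (e^{if} - 1) dΛ`
(`integral_cexp`), which is derived from the law and the independence of the increments.
`tendstoInDistribution_oneStep` combines the estimates for an abstract influence function. -/

section Auxiliary

open scoped ENNReal NNReal

/-! ### Observations as finite measures -/

/-- The kernel which maps a finite measure to itself and an infinite measure to `0`. -/
noncomputable def finitePart : Kernel (Measure ℝ) ℝ where
  toFun := {x : Measure ℝ | x univ < ∞}.indicator id
  measurable' := measurable_id.indicator
    (measurableSet_lt (Measure.measurable_coe MeasurableSet.univ) measurable_const)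

lemma finitePart_of_lt_top {x : Measure ℝ} (hx : x univ < ∞) : finitePart x = x :=
  indicator_of_mem (s := {x : Measure ℝ | x univ < ∞}) (f := id) hx

lemma finitePart_univ_lt_top (x : Measure ℝ) : finitePart x univ < ∞ := by
  by_cases hx : x univ < ∞
  · rwa [finitePart_of_lt_top hx]
  · have : finitePart x = 0 :=
      indicator_of_notMem (s := {x : Measure ℝ | x univ < ∞}) (f := id) hx
    simp [this]

instance (x : Measure ℝ) : IsFiniteMeasure (finitePart x) := ⟨finitePart_univ_lt_top x⟩

/-- Cutting along the integer part of the total mass gives countably many finite kernels, the `n`-th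
bounded by `n + 1`. S-finiteness is what makes integrals against an observation measurable in the
observation, also jointly with a parameter. -/
instance : IsSFiniteKernel finitePart := by
  classical
  have hm : Measurable fun x : Measure ℝ => ⌊(finitePart x univ).toReal⌋₊ :=
    Nat.measurable_floor.comp (finitePart.measurable_coe MeasurableSet.univ).ennreal_toReal
  have hs (n : ℕ) : MeasurableSet {x : Measure ℝ | ⌊(finitePart x univ).toReal⌋₊ = n} :=
    hm (measurableSet_singleton n)
  refine ⟨⟨fun n => Kernel.piecewise (hs n) finitePart 0, fun n => ?_, ?_⟩⟩
  · refine ⟨⟨(n : ℝ≥0∞) + 1, by finiteness, fun x => ?_⟩⟩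
    rw [Kernel.piecewise_apply]
    split_ifs with h
    · have h' : (finitePart x univ).toReal < n + 1 := by
        have := Nat.lt_floor_add_one (finitePart x univ).toReal
        rwa [show ⌊(finitePart x univ).toReal⌋₊ = n from h] at this
      rw [← ENNReal.ofReal_toReal (finitePart_univ_lt_top x).ne]
      calc ENNReal.ofReal (finitePart x univ).toReal ≤ ENNReal.ofReal (n + 1) :=
            ENNReal.ofReal_le_ofReal h'.le
        _ = n + 1 := by
            rw [ENNReal.ofReal_add (by positivity) (by positivity)]; simp
    · simp
  · ext x s hs'
    rw [Kernel.sum_apply, Measure.sum_apply _ hs',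
      tsum_eq_single ⌊(finitePart x univ).toReal⌋₊]
    · simp [Kernel.piecewise_apply]
    · intro n hn
      rw [Kernel.piecewise_apply, if_neg fun h => hn (mem_ofPred.1 h).symm]
      simp

/-! ### Intensity measure and Poisson law -/

/-- The intensity measure on `T` with density `lam`. -/
noncomputable def intensityMeasure (T : Set ℝ) (lam : ℝ → ℝ) : Measure ℝ :=
  (volume.restrict T).withDensity fun t => ENNReal.ofReal (lam t)

lemma isFiniteMeasure_intensityMeasure {T : Set ℝ} {lam : ℝ → ℝ} (h : IntegrableOn lam T) :
    IsFiniteMeasure (intensityMeasure T lam) :=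
  isFiniteMeasure_withDensity_ofReal h.2

lemma intensityMeasure_apply {T : Set ℝ} {lam : ℝ → ℝ} (hT : MeasurableSet T)
    (h : IntegrableOn lam T) (hpos : ∀ t ∈ T, 0 ≤ lam t) {A : Set ℝ} (hA : MeasurableSet A) :
    intensityMeasure T lam A = ENNReal.ofReal (∫ u in T ∩ A, lam u) := by
  rw [intensityMeasure, withDensity_apply _ hA, Measure.restrict_restrict hA, inter_comm,
    ofReal_integral_eq_lintegral_ofReal (h.mono_set inter_subset_left)]
  exact (ae_restrict_mem (hT.inter hA)).mono fun t ht => hpos t ht.1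

lemma integral_intensityMeasure {F : Type*} [NormedAddCommGroup F] [NormedSpace ℝ F]
    {T : Set ℝ} {lam : ℝ → ℝ} (hT : MeasurableSet T) (hm : Measurable lam)
    (hpos : ∀ t ∈ T, 0 ≤ lam t) (f : ℝ → F) :
    ∫ t, f t ∂(intensityMeasure T lam) = ∫ t in T, lam t • f t := by
  rw [intensityMeasure, integral_withDensity_eq_integral_toReal_smul (by fun_prop) (by simp)]
  refine setIntegral_congr_fun hT fun t ht => ?_
  simp only [ENNReal.toReal_ofReal (hpos t ht)]

section PoissonLaw

variable {Ω : Type*} [MeasurableSpace Ω] {P : Measure Ω} [IsProbabilityMeasure P]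

/-- Only the probabilities of the finite integers are given, but they already sum to one, so no mass
is left for other values: the Poisson law lies below the law of `Y`, and two probability measures so
ordered are equal. -/
lemma map_eq_map_poissonMeasure {Y : Ω → ℝ≥0∞} (hY : Measurable Y) {r : ℝ≥0}
    (h : ∀ k : ℕ, P {ω | Y ω = k} =
      ENNReal.ofReal (Real.exp (-r) * (r : ℝ) ^ k / (k.factorial : ℝ))) :
    P.map Y = (poissonMeasure r).map (Nat.cast : ℕ → ℝ≥0∞) := by
  have : IsProbabilityMeasure (P.map Y) := Measure.isProbabilityMeasure_map hY.aemeasurable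
  symm
  refine Measure.eq_of_le_of_isProbabilityMeasure (Measure.le_iff.2 fun s hs => ?_)
  rw [Measure.map_apply .of_discrete hs, Measure.map_apply hY hs, poissonMeasure,
    Measure.sum_apply _ .of_discrete]
  calc ∑' n : ℕ, (ENNReal.ofReal (Real.exp (-r) * (r : ℝ) ^ n / (n.factorial : ℝ)) •
        Measure.dirac n) (Nat.cast ⁻¹' s : Set ℕ)
      ≤ ∑' n : ℕ, P ({ω | Y ω = n} ∩ Y ⁻¹' s) := by
        refine ENNReal.tsum_le_tsum fun n => ?_
        by_cases hn : (n : ℝ≥0∞) ∈ s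
        · have : {ω | Y ω = n} ∩ Y ⁻¹' s = {ω | Y ω = n} :=
            inter_eq_left.2 fun ω hω => by simpa [show Y ω = n from hω] using hn
          rw [this, h n]
          simp [hn]
        · simp [hn]
    _ = P (⋃ n : ℕ, {ω | Y ω = n} ∩ Y ⁻¹' s) := by
        refine (measure_iUnion (fun i j hij => ?_) fun n =>
          (hY (measurableSet_singleton _)).inter (hY hs)).symm
        refine Disjoint.mono inter_subset_left inter_subset_left ?_
        refine disjoint_left.2 fun ω h1 h2 => hij ?_
        have : (i : ℝ≥0∞) = j := (show Y ω = i from h1).symm.trans h2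
        exact_mod_cast this
    _ ≤ P (Y ⁻¹' s) := measure_mono (iUnion_subset fun n => inter_subset_right)

lemma lintegral_natCast_poissonMeasure (r : ℝ≥0) :
    ∫⁻ k, (k : ℝ≥0∞) ∂(poissonMeasure r) = r := by
  have hs : HasSum (fun n : ℕ => Real.exp (-r) * (r : ℝ) ^ n / (n.factorial : ℝ) * (n : ℝ)) r := by
    -- The term `n = 0` vanishes, and `(n + 1) p_{n+1} = r p_n` reduces the mean to the total mass.
    rw [← hasSum_nat_add_iff' 1]
    have := (hasSum_one_poissonMeasure r).mul_left (r : ℝ)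
    simp only [mul_one] at this
    simp only [Finset.range_one, Finset.sum_singleton, Nat.cast_zero, mul_zero, sub_zero]
    refine this.congr_fun fun n => ?_
    rw [Nat.factorial_succ]
    push_cast
    field_simp
    ring
  rw [poissonMeasure, lintegral_sum_measure]
  simp only [lintegral_smul_measure, lintegral_dirac, smul_eq_mul]
  have e : ∀ n : ℕ, ENNReal.ofReal (Real.exp (-r) * (r : ℝ) ^ n / (n.factorial : ℝ)) * (n : ℝ≥0∞)
      = ENNReal.ofReal (Real.exp (-r) * (r : ℝ) ^ n / (n.factorial : ℝ) * (n : ℝ)) := fun n => by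
    rw [ENNReal.ofReal_mul (by positivity), ENNReal.ofReal_natCast]
  simp only [e]
  rw [← ENNReal.ofReal_tsum_of_nonneg (fun n => by positivity) hs.summable, hs.tsum_eq,
    ENNReal.ofReal_coe_nnreal]

end PoissonLaw

/-! ### Mean measure and increments of a Poisson process -/

namespace PoissonOneStep.IsPoissonProcess

variable {Ω : Type*} [MeasurableSpace Ω] {P : Measure Ω}
  {T : Set ℝ} {lam : ℝ → ℝ} {X : Ω → Measure ℝ}

lemma apply_inter (hX : IsPoissonProcess P T lam X) (ω : Ω) (A : Set ℝ) :
    X ω (T ∩ A) = X ω A := by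
  rw [inter_comm]
  exact measure_inter_conull (hX.carried ω)

lemma iIndepFun_Ioc (hX : IsPoissonProcess P T lam X) {t : ℕ → ℝ}
    (ht : Monotone t) : iIndepFun (fun (i : ℕ) ω => (X ω).real (Ioc (t i) (t (i + 1)))) P := by
  have h := hX.indep_increments t ht
  simp only [hX.apply_inter] at h
  exact h.comp (fun _ y => y.toReal) fun _ => by fun_prop

variable [IsProbabilityMeasure P]

lemma map_Ioc (hX : IsPoissonProcess P T lam X) (hT : MeasurableSet T) (hint : IntegrableOn lam T)
    (hpos : ∀ t ∈ T, 0 ≤ lam t) {s t : ℝ} (hst : s < t) :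
    P.map (fun ω => X ω (Ioc s t)) =
      (poissonMeasure (intensityMeasure T lam (Ioc s t)).toNNReal).map (Nat.cast : ℕ → ℝ≥0∞) := by
  refine map_eq_map_poissonMeasure
    (Y := fun ω => X ω (Ioc s t))
    ((Measure.measurable_coe measurableSet_Ioc).comp hX.measurable) fun k => ?_
  have h := hX.increment_law s t hst k
  simp only [hX.apply_inter] at h
  have h0 : 0 ≤ ∫ u in T ∩ Ioc s t, lam u :=
    setIntegral_nonneg (hT.inter measurableSet_Ioc) fun u hu => hpos u hu.1
  rw [h, intensityMeasure_apply hT hint hpos measurableSet_Ioc, ENNReal.coe_toNNReal_eq_toReal,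
    ENNReal.toReal_ofReal h0]

/-- The mean measure of a Poisson process is its intensity measure. -/
lemma bind_eq (hX : IsPoissonProcess P T lam X) (hT : MeasurableSet T) (hint : IntegrableOn lam T)
    (hpos : ∀ t ∈ T, 0 ≤ lam t) : P.bind X = intensityMeasure T lam := by
  have := isFiniteMeasure_intensityMeasure hint
  -- Half-open intervals determine the measure once one side is known to be finite; at this point
  -- that is only the intensity measure, which therefore comes first.
  symm
  refine Measure.ext_of_Ioc _ _ fun a b hab => ?_
  rw [Measure.bind_apply measurableSet_Ioc hX.measurable.aemeasurable]
  have hm : Measurable fun ω => X ω (Ioc a b) :=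
    (Measure.measurable_coe measurableSet_Ioc).comp hX.measurable
  rw [← lintegral_map (f := fun y => y) measurable_id hm, hX.map_Ioc hT hint hpos hab,
    lintegral_map (f := fun y => y) measurable_id .of_discrete, lintegral_natCast_poissonMeasure,
    ENNReal.coe_toNNReal (measure_ne_top _ _)]

lemma ae_finite (hX : IsPoissonProcess P T lam X) (hT : MeasurableSet T)
    (hint : IntegrableOn lam T) (hpos : ∀ t ∈ T, 0 ≤ lam t) : ∀ᵐ ω ∂P, X ω univ < ∞ := by
  have := isFiniteMeasure_intensityMeasure hint
  refine ae_lt_top ((Measure.measurable_coe MeasurableSet.univ).comp hX.measurable) ?_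
  rw [← Measure.bind_apply MeasurableSet.univ hX.measurable.aemeasurable,
    hX.bind_eq hT hint hpos]
  exact measure_ne_top _ _

lemma ae_finitePart (hX : IsPoissonProcess P T lam X) (hT : MeasurableSet T)
    (hint : IntegrableOn lam T) (hpos : ∀ t ∈ T, 0 ≤ lam t) : ∀ᵐ ω ∂P, finitePart (X ω) = X ω :=
  (hX.ae_finite hT hint hpos).mono fun _ h => finitePart_of_lt_top h

/-- Campbell's formula. It transfers `L¹` approximation under the intensity measure to the random
integrals. -/
lemma lintegral_lintegral (hX : IsPoissonProcess P T lam X) (hT : MeasurableSet T)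
    (hint : IntegrableOn lam T) (hpos : ∀ t ∈ T, 0 ≤ lam t) {f : ℝ → ℝ≥0∞} (hf : Measurable f) :
    ∫⁻ ω, ∫⁻ t, f t ∂(finitePart (X ω)) ∂P = ∫⁻ t, f t ∂(intensityMeasure T lam) := by
  rw [← hX.bind_eq hT hint hpos,
    Measure.lintegral_bind hX.measurable.aemeasurable hf.aemeasurable]
  exact lintegral_congr_ae ((hX.ae_finitePart hT hint hpos).mono fun ω h => by simp only [h])

/-- The characteristic function of the number of jumps in `(s, t]`. -/
lemma integral_cexp_Ioc (hX : IsPoissonProcess P T lam X) (hT : MeasurableSet T)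
    (hint : IntegrableOn lam T) (hpos : ∀ t ∈ T, 0 ≤ lam t) {s t : ℝ} (hst : s ≤ t) (u : ℝ) :
    ∫ ω, Complex.exp (((X ω).real (Ioc s t) * u : ℝ) * Complex.I) ∂P =
      Complex.exp ((intensityMeasure T lam).real (Ioc s t) *
        (Complex.exp (u * Complex.I) - 1)) := by
  rcases hst.eq_or_lt with rfl | hst
  · simp
  have hm : Measurable fun ω => X ω (Ioc s t) :=
    (Measure.measurable_coe measurableSet_Ioc).comp hX.measurable
  have := charFun_map_cast_poissonMeasure (intensityMeasure T lam (Ioc s t)).toNNReal u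
  rw [charFun_apply, integral_map .of_discrete (by fun_prop)] at this
  simp only [Real.inner_apply] at this
  rw [show (intensityMeasure T lam).real (Ioc s t) =
    ((intensityMeasure T lam (Ioc s t)).toNNReal : ℝ) from rfl]
  refine Eq.trans ?_ this
  calc ∫ ω, Complex.exp (((X ω).real (Ioc s t) * u : ℝ) * Complex.I) ∂P
      = ∫ y, Complex.exp ((y.toReal * u : ℝ) * Complex.I) ∂(P.map fun ω => X ω (Ioc s t)) := by
        rw [integral_map hm.aemeasurable
          (Measurable.aestronglyMeasurable (by fun_prop))]
        rfl
    _ = _ := by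
        rw [hX.map_Ioc hT hint hpos hst, integral_map .of_discrete
          (Measurable.aestronglyMeasurable (by fun_prop))]
        simp

/-- The characteristic function of the integral of a step function. -/
lemma integral_cexp_sum (hX : IsPoissonProcess P T lam X) (hT : MeasurableSet T)
    (hint : IntegrableOn lam T) (hpos : ∀ t ∈ T, 0 ≤ lam t) {t : ℕ → ℝ} (ht : Monotone t)
    (c : ℕ → ℝ) (M : ℕ) :
    ∫ ω, Complex.exp ((∑ i ∈ Finset.range M,
        (X ω).real (Ioc (t i) (t (i + 1))) * c i : ℝ) * Complex.I) ∂P =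
      Complex.exp (∑ i ∈ Finset.range M, (intensityMeasure T lam).real (Ioc (t i) (t (i + 1))) *
        (Complex.exp (c i * Complex.I) - 1)) := by
  have hm (i : ℕ) : Measurable fun ω => (X ω).real (Ioc (t i) (t (i + 1))) :=
    ((Measure.measurable_coe measurableSet_Ioc).comp hX.measurable).ennreal_toReal
  have hind : iIndepFun (fun (i : ℕ) ω => (X ω).real (Ioc (t i) (t (i + 1))) * c i) P :=
    (hX.iIndepFun_Ioc ht).comp (fun i y => y * c i) fun _ => by fun_prop
  have h := congrFun ((hind.restrict _).charFun_map_fun_finsetSum_eq_prod (s := Finset.range M)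
    fun i _ => ((hm i).mul_const _).aemeasurable) 1
  have hm' (i : ℕ) : Measurable fun ω => (X ω).real (Ioc (t i) (t (i + 1))) * c i :=
    (hm i).mul_const _
  rw [charFun_apply, integral_map (Finset.measurable_fun_sum _ fun i _ => hm' i).aemeasurable
    (by fun_prop), Finset.prod_apply] at h
  simp only [Real.inner_apply, mul_one] at h
  rw [h, Complex.exp_sum]
  refine Finset.prod_congr rfl fun i _ => ?_
  rw [charFun_apply, integral_map (hm' i).aemeasurable (by fun_prop)]
  simpa using hX.integral_cexp_Ioc hT hint hpos (ht (Nat.le_succ i)) (c i)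

end PoissonOneStep.IsPoissonProcess

/-! ### Characteristic functional: from step functions to bounded integrands -/

/-- The `i`-th point of the grid of mesh `1 / (m + 1)` on `[-R, ∞)`. -/
noncomputable def gridPoint (R m i : ℕ) : ℝ := -R + i / (m + 1)

lemma monotone_gridPoint (R m : ℕ) : Monotone (gridPoint R m) := fun i j hij => by
  have : (i : ℝ) ≤ j := by exact_mod_cast hij
  unfold gridPoint
  gcongr

/-- Riemann sums converge because `g` is uniformly continuous; the `2R(m + 1)` cells tile `(-R, R]`,
off which `g` vanishes. The same grid serves a realization of the process (with values in `ℝ`) and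
the intensity measure (with values in `ℂ`). -/
lemma tendsto_sum_gridPoint {F : Type*} [NormedAddCommGroup F] [NormedSpace ℝ F] [CompleteSpace F]
    (μ : Measure ℝ) [IsFiniteMeasure μ] {g : ℝ → F} (hg : Continuous g) {R : ℕ}
    (hR : ∀ t : ℝ, R ≤ |t| → g t = 0) :
    Tendsto (fun m : ℕ => ∑ i ∈ Finset.range (2 * R * (m + 1)),
      μ.real (Ioc (gridPoint R m i) (gridPoint R m (i + 1))) • g (gridPoint R m i)) atTop
      (𝓝 (∫ t, g t ∂μ)) := by
  have hcomp : HasCompactSupport g :=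
    HasCompactSupport.intro (isCompact_Icc (a := -(R : ℝ)) (b := R)) fun t ht => hR t <| by
      by_contra! h
      exact ht (abs_le.1 h.le)
  have hgi : Integrable g μ := hg.integrable_of_hasCompactSupport hcomp
  have hunif := hcomp.uniformContinuous_of_continuous hg
  rw [Metric.tendsto_atTop]
  intro ε hε
  have hε' : 0 < ε / (μ.real univ + 1) := by positivity
  obtain ⟨η, hη, hη'⟩ := Metric.uniformContinuous_iff.1 hunif _ hε'
  obtain ⟨m₀, hm₀⟩ := exists_nat_one_div_lt hη
  refine ⟨m₀, fun m hm => ?_⟩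
  have hmesh : (1 : ℝ) / (m + 1) < η :=
    (one_div_le_one_div_of_le (by positivity) (by gcongr)).trans_lt hm₀
  have h0 : gridPoint R m 0 = -R := by simp [gridPoint]
  have hM : gridPoint R m (2 * R * (m + 1)) = R := by
    simp only [gridPoint]
    push_cast
    field_simp
    ring
  have hint : ∫ t, g t ∂μ = ∑ i ∈ Finset.range (2 * R * (m + 1)),
      ∫ t in Ioc (gridPoint R m i) (gridPoint R m (i + 1)), g t ∂μ := by
    have h1 := intervalIntegral.sum_integral_adjacent_intervals (f := g) (μ := μ)
      (a := gridPoint R m) (n := 2 * R * (m + 1)) fun k _ => hgi.intervalIntegrable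
    simp only [intervalIntegral.integral_of_le (monotone_gridPoint R m (Nat.le_succ _))] at h1
    rw [h1, h0, hM, intervalIntegral.integral_of_le (by linarith [R.cast_nonneg (α := ℝ)]),
      setIntegral_eq_integral_of_forall_compl_eq_zero]
    intro t ht
    refine hR t ?_
    by_contra! h
    exact ht ⟨(abs_lt.1 h).1, (abs_lt.1 h).2.le⟩
  have hone : ∑ i ∈ Finset.range (2 * R * (m + 1)),
      μ.real (Ioc (gridPoint R m i) (gridPoint R m (i + 1))) ≤ μ.real univ := by
    have h1 := intervalIntegral.sum_integral_adjacent_intervals (f := fun _ => (1 : ℝ)) (μ := μ)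
      (a := gridPoint R m) (n := 2 * R * (m + 1))
      fun k _ => (integrable_const 1).intervalIntegrable
    simp only [intervalIntegral.integral_of_le (monotone_gridPoint R m (Nat.le_succ _))] at h1
    rw [h0, hM, intervalIntegral.integral_of_le (by linarith [R.cast_nonneg (α := ℝ)])] at h1
    simp only [setIntegral_const, smul_eq_mul, mul_one] at h1
    rw [h1]
    exact measureReal_mono (subset_univ _)
  rw [dist_eq_norm, hint, ← Finset.sum_sub_distrib]
  calc ‖∑ i ∈ Finset.range (2 * R * (m + 1)),
        (μ.real (Ioc (gridPoint R m i) (gridPoint R m (i + 1))) • g (gridPoint R m i) -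
          ∫ t in Ioc (gridPoint R m i) (gridPoint R m (i + 1)), g t ∂μ)‖
      ≤ ∑ i ∈ Finset.range (2 * R * (m + 1)), ε / (μ.real univ + 1) *
          μ.real (Ioc (gridPoint R m i) (gridPoint R m (i + 1))) := by
        refine norm_sum_le_of_le _ fun i _ => ?_
        rw [← setIntegral_const, ← integral_sub (integrable_const _) hgi.integrableOn]
        refine norm_setIntegral_le_of_norm_le_const (by finiteness) fun t ht => ?_
        rw [← dist_eq_norm]
        refine (hη' ?_).le
        rw [dist_comm, Real.dist_eq, abs_of_pos (by linarith [ht.1])]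
        refine lt_of_le_of_lt ?_ hmesh
        have : gridPoint R m (i + 1) = gridPoint R m i + 1 / (m + 1) := by
          simp only [gridPoint]
          push_cast
          ring
        linarith [ht.2]
    _ = ε / (μ.real univ + 1) * ∑ i ∈ Finset.range (2 * R * (m + 1)),
          μ.real (Ioc (gridPoint R m i) (gridPoint R m (i + 1))) := by rw [Finset.mul_sum]
    _ ≤ ε / (μ.real univ + 1) * μ.real univ := by gcongr
    _ < ε := by
        rw [div_mul_eq_mul_div, div_lt_iff₀ (by positivity)]
        linarith

lemma norm_cexp_mul_I_sub_le (a b : ℝ) :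
    ‖Complex.exp (a * Complex.I) - Complex.exp (b * Complex.I)‖ ≤ ‖a - b‖ := by
  have h : Complex.exp (a * Complex.I) - Complex.exp (b * Complex.I) =
      Complex.exp (b * Complex.I) * (Complex.exp (Complex.I * (a - b : ℝ)) - 1) := by
    rw [mul_sub, ← Complex.exp_add]
    push_cast
    ring_nf
  rw [h, norm_mul, Complex.norm_exp_ofReal_mul_I, one_mul]
  exact Real.norm_exp_I_mul_ofReal_sub_one_le

lemma measurable_integral_finitePart {F : Type*} [NormedAddCommGroup F] [NormedSpace ℝ F]
    [MeasurableSpace F] [BorelSpace F] {f : ℝ → F} (hf : StronglyMeasurable f) :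
    Measurable fun x : Measure ℝ => ∫ t, f t ∂(finitePart x) :=
  (StronglyMeasurable.integral_kernel_prod_right' (κ := finitePart)
    (f := fun p : Measure ℝ × ℝ => f p.2) (hf.comp_measurable measurable_snd)).measurable

namespace PoissonOneStep.IsPoissonProcess

variable {Ω : Type*} [MeasurableSpace Ω] {P : Measure Ω} [IsProbabilityMeasure P]
  {T : Set ℝ} {lam : ℝ → ℝ} {X : Ω → Measure ℝ}

/-- For step functions on the grid the formula is exact by independence of increments. As the mesh
shrinks, the left side converges by dominated convergence with bound `1`; on the right the exponent
is a Riemann sum of `e^{ig} - 1`, which is again continuous and vanishes where `g` does. -/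
lemma integral_cexp_of_continuous (hX : IsPoissonProcess P T lam X) (hT : MeasurableSet T)
    (hint : IntegrableOn lam T) (hpos : ∀ t ∈ T, 0 ≤ lam t) {g : ℝ → ℝ} (hg : Continuous g)
    (hc : HasCompactSupport g) :
    ∫ ω, Complex.exp ((∫ t, g t ∂(finitePart (X ω)) : ℝ) * Complex.I) ∂P =
      Complex.exp (∫ t, (Complex.exp (g t * Complex.I) - 1) ∂(intensityMeasure T lam)) := by
  have := isFiniteMeasure_intensityMeasure hint
  obtain ⟨R, hR⟩ : ∃ R : ℕ, ∀ t : ℝ, R ≤ |t| → g t = 0 := by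
    obtain ⟨r, hr⟩ := hc.isCompact.isBounded.subset_ball 0
    obtain ⟨R, hR⟩ := exists_nat_ge r
    refine ⟨R, fun t ht => by_contra fun h => ?_⟩
    have := hr (subset_tsupport g (Function.mem_support.2 h))
    rw [mem_ball_zero_iff, Real.norm_eq_abs] at this
    linarith
  have hR' : ∀ t : ℝ, R ≤ |t| → Complex.exp (g t * Complex.I) - 1 = 0 := fun t ht => by
    simp [hR t ht]
  refine tendsto_nhds_unique (f := fun m : ℕ => ∫ ω, Complex.exp ((∑ i ∈ Finset.range
    (2 * R * (m + 1)), (X ω).real (Ioc (gridPoint R m i) (gridPoint R m (i + 1))) *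
      g (gridPoint R m i) : ℝ) * Complex.I) ∂P) (l := atTop) ?_ ?_
  · refine tendsto_integral_of_dominated_convergence (fun _ => 1) (fun m => ?_)
      (integrable_const _) (fun m => ?_) ?_
    · have hm (i : ℕ) : Measurable fun ω =>
          (X ω).real (Ioc (gridPoint R m i) (gridPoint R m (i + 1))) * g (gridPoint R m i) :=
        ((Measure.measurable_coe measurableSet_Ioc).comp hX.measurable).ennreal_toReal.mul_const _
      have := Finset.measurable_fun_sum (Finset.range (2 * R * (m + 1))) fun i _ => hm i
      exact Measurable.aestronglyMeasurable (by fun_prop)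
    · exact ae_of_all _ fun ω => (Complex.norm_exp_ofReal_mul_I _).le
    · filter_upwards [hX.ae_finitePart hT hint hpos] with ω hω
      have h := tendsto_sum_gridPoint (finitePart (X ω)) hg hR
      simp only [hω, smul_eq_mul] at h ⊢
      exact ((Complex.continuous_exp.comp (by fun_prop : Continuous fun x : ℝ =>
        (x : ℂ) * Complex.I)).tendsto _).comp h
  · simp only [hX.integral_cexp_sum hT hint hpos (monotone_gridPoint R _)]
    have h := tendsto_sum_gridPoint (intensityMeasure T lam)
      (g := fun t => Complex.exp (g t * Complex.I) - 1) (by fun_prop) hR'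
    simp only [Complex.real_smul] at h
    exact (Complex.continuous_exp.tendsto _).comp h

/-- The characteristic functional of a Poisson process. -/
lemma integral_cexp (hX : IsPoissonProcess P T lam X) (hT : MeasurableSet T)
    (hint : IntegrableOn lam T) (hpos : ∀ t ∈ T, 0 ≤ lam t) {f : ℝ → ℝ} (hf : Measurable f)
    {B : ℝ} (hB : ∀ t, ‖f t‖ ≤ B) :
    ∫ ω, Complex.exp ((∫ t, f t ∂(finitePart (X ω)) : ℝ) * Complex.I) ∂P =
      Complex.exp (∫ t, (Complex.exp (f t * Complex.I) - 1) ∂(intensityMeasure T lam)) := by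
  have := isFiniteMeasure_intensityMeasure hint
  have hfi (μ : Measure ℝ) [IsFiniteMeasure μ] : Integrable f μ :=
    Integrable.of_bound hf.aestronglyMeasurable B (ae_of_all _ hB)
  -- Continuous compactly supported `g k` approximate `f` in `L¹` of the intensity measure. Since `x
  -- ↦ e^{ix}` is 1-Lipschitz, the left side and the exponent on the right move by at most this `L¹`
  -- distance, the former through Campbell's formula.
  choose g hgc hgε hgcont hgi using fun k : ℕ =>
    (hfi (intensityMeasure T lam)).exists_hasCompactSupport_integral_sub_le
      (Nat.one_div_pos_of_nat (α := ℝ) (n := k))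
  have hgi' (k : ℕ) (μ : Measure ℝ) [IsFiniteMeasure μ] : Integrable (g k) μ :=
    (hgcont k).integrable_of_hasCompactSupport (hgc k)
  have hε (k : ℕ) : ∫⁻ t, ‖g k t - f t‖ₑ ∂(intensityMeasure T lam) ≤
      ENNReal.ofReal (1 / ((k : ℝ) + 1)) := by
    refine le_trans (le_of_eq ?_) (ENNReal.ofReal_le_ofReal (hgε k))
    rw [ofReal_integral_norm_eq_lintegral_enorm (f := fun t => f t - g k t) ((hfi _).sub (hgi k))]
    exact lintegral_congr fun t => by rw [← enorm_neg, neg_sub]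
  have hlim : Tendsto (fun k : ℕ => ENNReal.ofReal (1 / ((k : ℝ) + 1))) atTop (𝓝 0) := by
    simpa using ENNReal.tendsto_ofReal tendsto_one_div_add_atTop_nhds_zero_nat
  have hexp (a b : ℝ) : ‖Complex.exp (a * Complex.I) - Complex.exp (b * Complex.I)‖ₑ ≤
      ‖a - b‖ₑ := enorm_le_iff_norm_le.2 (norm_cexp_mul_I_sub_le a b)
  have hmi {f : ℝ → ℝ} (hf : Measurable f) :
      Integrable (fun ω => Complex.exp ((∫ t, f t ∂(finitePart (X ω)) : ℝ) * Complex.I)) P := by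
    have h1 := (measurable_integral_finitePart hf.stronglyMeasurable).comp hX.measurable
    simp only [Function.comp_def] at h1
    exact Integrable.of_bound (C := 1) (Measurable.aestronglyMeasurable (by fun_prop))
      (ae_of_all _ fun ω => (Complex.norm_exp_ofReal_mul_I _).le)
  have hmi' {f : ℝ → ℝ} (hf : Measurable f) : Integrable
      (fun t => Complex.exp (f t * Complex.I) - 1) (intensityMeasure T lam) :=
    (Integrable.of_bound (C := 1) (Measurable.aestronglyMeasurable (by fun_prop))
      (ae_of_all _ fun ω => (Complex.norm_exp_ofReal_mul_I _).le)).sub (integrable_const _)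
  refine tendsto_nhds_unique (f := fun k : ℕ =>
    ∫ ω, Complex.exp ((∫ t, g k t ∂(finitePart (X ω)) : ℝ) * Complex.I) ∂P) (l := atTop) ?_ ?_
  · rw [tendsto_iff_edist_tendsto_0]
    refine tendsto_of_tendsto_of_tendsto_of_le_of_le tendsto_const_nhds hlim
      (fun _ => zero_le) fun k => ?_
    rw [edist_eq_enorm_sub, ← integral_sub (hmi (hgcont k).measurable) (hmi hf)]
    calc ‖∫ ω, (Complex.exp ((∫ t, g k t ∂(finitePart (X ω)) : ℝ) * Complex.I) -
            Complex.exp ((∫ t, f t ∂(finitePart (X ω)) : ℝ) * Complex.I)) ∂P‖ₑ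
        ≤ ∫⁻ ω, ‖Complex.exp ((∫ t, g k t ∂(finitePart (X ω)) : ℝ) * Complex.I) -
            Complex.exp ((∫ t, f t ∂(finitePart (X ω)) : ℝ) * Complex.I)‖ₑ ∂P :=
          enorm_integral_le_lintegral_enorm _
      _ ≤ ∫⁻ ω, ∫⁻ t, ‖g k t - f t‖ₑ ∂(finitePart (X ω)) ∂P := by
          refine lintegral_mono fun ω => (hexp _ _).trans ?_
          rw [← integral_sub (hgi' k _) (hfi _)]
          exact enorm_integral_le_lintegral_enorm _
      _ = ∫⁻ t, ‖g k t - f t‖ₑ ∂(intensityMeasure T lam) :=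
          hX.lintegral_lintegral hT hint hpos ((hgcont k).measurable.sub hf).enorm
      _ ≤ ENNReal.ofReal (1 / ((k : ℝ) + 1)) := hε k
  · simp only [hX.integral_cexp_of_continuous hT hint hpos (hgcont _) (hgc _)]
    refine (Complex.continuous_exp.tendsto _).comp ?_
    rw [tendsto_iff_edist_tendsto_0]
    refine tendsto_of_tendsto_of_tendsto_of_le_of_le tendsto_const_nhds hlim
      (fun _ => zero_le) fun k => ?_
    rw [edist_eq_enorm_sub, ← integral_sub (hmi' (hgcont k).measurable) (hmi' hf)]
    refine (enorm_integral_le_lintegral_enorm _).trans (le_trans ?_ (hε k))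
    refine lintegral_mono fun t => ?_
    simp only [sub_sub_sub_cancel_right]
    exact hexp _ _

end PoissonOneStep.IsPoissonProcess

/-! ### Compensated integrals: characteristic functions and second moments -/

/-- Mean value inequality: the derivative `i(e^{iy} - 1)` has norm at most `|y| ≤ |x|` between `0`
and `x`. The sharp constant `1/2` is not needed. -/
lemma norm_cexp_mul_I_sub_one_sub_le (x : ℝ) :
    ‖Complex.exp (x * Complex.I) - 1 - x * Complex.I‖ ≤ x ^ 2 := by
  have hd (y : ℝ) : HasDerivAt (fun y : ℝ => Complex.exp (y * Complex.I) - 1 - y * Complex.I)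
      (Complex.exp (y * Complex.I) * Complex.I - Complex.I) y := by
    have h1 : HasDerivAt (fun y : ℝ => (y : ℂ) * Complex.I) Complex.I y := by
      simpa using (Complex.ofRealCLM.hasDerivAt (x := y)).mul_const Complex.I
    exact (h1.cexp.sub_const 1).sub h1
  have h := (convex_uIcc (0 : ℝ) x).norm_image_sub_le_of_norm_hasDerivWithin_le (C := |x|)
    (fun y _ => (hd y).hasDerivWithinAt) (fun y hy => ?_) left_mem_uIcc right_mem_uIcc
  · simpa [← sq_abs x, sq] using h
  · have e : Complex.exp (y * Complex.I) * Complex.I - Complex.I =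
        (Complex.exp (y * Complex.I) - Complex.exp ((0 : ℝ) * Complex.I)) * Complex.I := by
      simp [sub_mul]
    rw [e, norm_mul, Complex.norm_I, mul_one]
    refine (norm_cexp_mul_I_sub_le y 0).trans ?_
    simpa using abs_sub_left_of_mem_uIcc hy

/-- The half-plane is convex and the derivative of `exp` has norm at most `1` there. -/
lemma Complex.norm_exp_sub_one_le_of_re_nonpos {w : ℂ} (hw : w.re ≤ 0) :
    ‖Complex.exp w - 1‖ ≤ ‖w‖ := by
  have h := (convex_halfSpace_re_le 0).norm_image_sub_le_of_norm_hasDerivWithin_le (C := 1)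
    (fun z _ => (Complex.hasDerivAt_exp z).hasDerivWithinAt) (fun z hz => ?_)
    (show (0 : ℂ) ∈ {z : ℂ | z.re ≤ 0} by simp) (show w ∈ {z : ℂ | z.re ≤ 0} from hw)
  · simpa using h
  · rw [Complex.norm_exp]
    exact Real.exp_le_one_iff.2 hz

/-- A bound for the characteristic function near `0` controls the second moment. -/
lemma lintegral_sq_le_of_norm_charFun_sub_one_le {Ω : Type*} [MeasurableSpace Ω] {P : Measure Ω}
    [IsProbabilityMeasure P] {Z : Ω → ℝ} (hZ : Measurable Z) {V : ℝ}
    (h : ∀ s : ℝ, ‖∫ ω, Complex.exp ((s * Z ω : ℝ) * Complex.I) ∂P - 1‖ ≤ s ^ 2 * V) :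
    ∫⁻ ω, ENNReal.ofReal (Z ω ^ 2) ∂P ≤ ENNReal.ofReal (2 * V) := by
  set s : ℕ → ℝ := fun n => 1 / ((n : ℝ) + 1) with hs
  have hs0 (n : ℕ) : 0 < s n := Nat.one_div_pos_of_nat
  have hslim : Tendsto s atTop (𝓝[≠] 0) :=
    tendsto_nhdsWithin_iff.2 ⟨tendsto_one_div_add_atTop_nhds_zero_nat,
      Eventually.of_forall fun n => (hs0 n).ne'⟩
  -- These functions are nonnegative, tend pointwise to `Z²`, and have means controlled by the real
  -- part of the characteristic function. Fatou's lemma then bounds the mean of `Z²` without any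
  -- prior integrability of `Z`.
  set F : ℕ → Ω → ℝ := fun n ω => 2 * (1 - Real.cos (s n * Z ω)) / s n ^ 2 with hF
  have hFm (n : ℕ) : Measurable (F n) := by fun_prop
  have hF0 (n : ℕ) (ω : Ω) : 0 ≤ F n ω :=
    div_nonneg (mul_nonneg zero_le_two (sub_nonneg.2 (Real.cos_le_one _))) (sq_nonneg _)
  have hFlim (ω : Ω) : Tendsto (fun n => F n ω) atTop (𝓝 (Z ω ^ 2)) := by
    -- By `1 - cos x = 2 sin²(x/2)`, `F n` is the square of a difference quotient of this function
    -- at `0`.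
    have hd : HasDerivAt (fun y : ℝ => 2 * Real.sin (y * Z ω / 2)) (Z ω) 0 := by
      have h1 : HasDerivAt (fun y : ℝ => y * Z ω / 2) (Z ω / 2) 0 := by
        simpa using ((hasDerivAt_id (0 : ℝ)).mul_const (Z ω)).div_const 2
      have h2 := (h1.sin.const_mul 2)
      have e : 2 * (Real.cos (0 * Z ω / 2) * (Z ω / 2)) = Z ω := by
        rw [zero_mul, zero_div, Real.cos_zero]
        ring
      rwa [e] at h2
    have h1 := ((hd.tendsto_slope_zero).comp hslim).pow 2
    refine h1.congr fun n => ?_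
    have h2 : Real.cos (s n * Z ω) = 1 - 2 * Real.sin (s n * Z ω / 2) ^ 2 := by
      have := Real.cos_sq' (s n * Z ω / 2)
      have h3 := Real.cos_two_mul (s n * Z ω / 2)
      rw [show 2 * (s n * Z ω / 2) = s n * Z ω by ring] at h3
      linarith
    have h4 := (hs0 n).ne'
    simp only [Function.comp_apply, zero_add, zero_mul, zero_div, Real.sin_zero, mul_zero, sub_zero,
      smul_eq_mul, hF, h2]
    field_simp
    ring
  have hFint (n : ℕ) : ∫⁻ ω, ENNReal.ofReal (F n ω) ∂P ≤ ENNReal.ofReal (2 * V) := by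
    have hcos : Integrable (fun ω => Real.cos (s n * Z ω)) P :=
      Integrable.of_bound (C := 1) (Measurable.aestronglyMeasurable (by fun_prop))
        (ae_of_all _ fun ω => Real.abs_cos_le_one _)
    have hFi : Integrable (F n) P :=
      (((integrable_const 1).sub hcos).const_mul 2).div_const _
    rw [← ofReal_integral_eq_lintegral_ofReal hFi (ae_of_all _ (hF0 n))]
    refine ENNReal.ofReal_le_ofReal ?_
    have hexp : Integrable (fun ω => Complex.exp ((s n * Z ω : ℝ) * Complex.I)) P :=
      Integrable.of_bound (C := 1) (Measurable.aestronglyMeasurable (by fun_prop))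
        (ae_of_all _ fun ω => (Complex.norm_exp_ofReal_mul_I _).le)
    have hre : (∫ ω, Complex.exp ((s n * Z ω : ℝ) * Complex.I) ∂P).re =
        ∫ ω, Real.cos (s n * Z ω) ∂P := by
      rw [← RCLike.re_eq_complex_re, ← integral_re hexp]
      exact integral_congr_ae (ae_of_all _ fun ω => Complex.exp_ofReal_mul_I_re _)
    have h1 : 1 - ∫ ω, Real.cos (s n * Z ω) ∂P ≤ s n ^ 2 * V := by
      refine le_trans ?_ (h (s n))
      rw [norm_sub_rev, ← hre]
      exact Complex.re_le_norm (1 - ∫ ω, Complex.exp ((s n * Z ω : ℝ) * Complex.I) ∂P)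
    simp only [hF]
    rw [integral_div, integral_const_mul, integral_sub (integrable_const 1) hcos]
    rw [div_le_iff₀ (pow_pos (hs0 n) 2)]
    simp only [integral_const, probReal_univ, smul_eq_mul, mul_one]
    nlinarith
  calc ∫⁻ ω, ENNReal.ofReal (Z ω ^ 2) ∂P
      = ∫⁻ ω, liminf (fun n => ENNReal.ofReal (F n ω)) atTop ∂P :=
        lintegral_congr fun ω => ((ENNReal.tendsto_ofReal (hFlim ω)).liminf_eq).symm
    _ ≤ liminf (fun n => ∫⁻ ω, ENNReal.ofReal (F n ω) ∂P) atTop :=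
        lintegral_liminf_le fun n => (hFm n).ennreal_ofReal
    _ ≤ ENNReal.ofReal (2 * V) :=
        (liminf_le_liminf (Eventually.of_forall hFint)).trans (by simp)

/-- The integral of `f` against `x - Λ`, where `x` is replaced by `0` if it is infinite. -/
noncomputable def compensatedIntegral {F : Type*} [NormedAddCommGroup F] [NormedSpace ℝ F]
    (Λ : Measure ℝ) (f : ℝ → F) (x : Measure ℝ) : F :=
  ∫ t, f t ∂(finitePart x) - ∫ t, f t ∂Λ

lemma measurable_compensatedIntegral {F : Type*} [NormedAddCommGroup F] [NormedSpace ℝ F]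
    [MeasurableSpace F] [BorelSpace F] [SecondCountableTopology F] (Λ : Measure ℝ) {f : ℝ → F}
    (hf : Measurable f) : Measurable (compensatedIntegral Λ f) :=
  (measurable_integral_finitePart hf.stronglyMeasurable).sub_const _

lemma ContinuousLinearMap.compensatedIntegral_comp {F G : Type*} [NormedAddCommGroup F]
    [NormedSpace ℝ F] [NormedAddCommGroup G] [NormedSpace ℝ G] [CompleteSpace F] [CompleteSpace G]
    [MeasurableSpace F] [BorelSpace F] [SecondCountableTopology F]
    (L : F →L[ℝ] G) (Λ : Measure ℝ) [IsFiniteMeasure Λ] {f : ℝ → F} (hf : Measurable f) {B : ℝ}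
    (hB : ∀ t, ‖f t‖ ≤ B) (x : Measure ℝ) :
    compensatedIntegral Λ (fun t => L (f t)) x = L (compensatedIntegral Λ f x) := by
  have hfi (μ : Measure ℝ) [IsFiniteMeasure μ] : Integrable f μ :=
    Integrable.of_bound hf.aestronglyMeasurable B (ae_of_all _ hB)
  simp only [compensatedIntegral, L.integral_comp_comm (hfi _), map_sub]

section Sums

variable {Ω : Type*} [MeasurableSpace Ω] {P : Measure Ω} [IsProbabilityMeasure P]
  {T : Set ℝ} {lam : ℝ → ℝ} {X : ℕ → Ω → Measure ℝ}

/-- Subtracting the deterministic mean adds `-if` under the integral in the exponent of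
`integral_cexp`, and independence multiplies the exponent by the number of terms. -/
lemma integral_cexp_sum_compensatedIntegral (hX : ∀ j, IsPoissonProcess P T lam (X j))
    (hindep : iIndepFun X P) (hT : MeasurableSet T) (hint : IntegrableOn lam T)
    (hpos : ∀ t ∈ T, 0 ≤ lam t) {f : ℝ → ℝ} (hf : Measurable f) {B : ℝ} (hB : ∀ t, ‖f t‖ ≤ B)
    (S : Finset ℕ) :
    ∫ ω, Complex.exp ((∑ j ∈ S, compensatedIntegral (intensityMeasure T lam) f (X j ω) : ℝ) *
        Complex.I) ∂P =
      Complex.exp (S.card * ∫ t, (Complex.exp (f t * Complex.I) - 1 - f t * Complex.I)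
        ∂(intensityMeasure T lam)) := by
  have := isFiniteMeasure_intensityMeasure hint
  set Λ := intensityMeasure T lam with hΛ
  have hfi : Integrable f Λ := Integrable.of_bound hf.aestronglyMeasurable B (ae_of_all _ hB)
  have hm (j : ℕ) : Measurable fun ω => compensatedIntegral Λ f (X j ω) :=
    (measurable_compensatedIntegral Λ hf).comp (hX j).measurable
  have hone (j : ℕ) : ∫ ω, Complex.exp ((compensatedIntegral Λ f (X j ω) : ℝ) * Complex.I) ∂P =
      Complex.exp (∫ t, (Complex.exp (f t * Complex.I) - 1 - f t * Complex.I) ∂Λ) := by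
    have h1 : Integrable (fun t => Complex.exp (f t * Complex.I) - 1) Λ :=
      (Integrable.of_bound (C := 1) (Measurable.aestronglyMeasurable (by fun_prop))
        (ae_of_all _ fun ω => (Complex.norm_exp_ofReal_mul_I _).le)).sub (integrable_const _)
    have h2 : Integrable (fun t => (f t : ℂ) * Complex.I) Λ := hfi.ofReal.mul_const _
    have h3 (ω : Ω) : Complex.exp ((compensatedIntegral Λ f (X j ω) : ℝ) * Complex.I) =
        Complex.exp ((∫ t, f t ∂(finitePart (X j ω)) : ℝ) * Complex.I) *
          Complex.exp (-((∫ t, f t ∂Λ : ℝ) * Complex.I)) := by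
      rw [← Complex.exp_add, compensatedIntegral]
      push_cast
      ring_nf
    simp only [h3]
    rw [integral_mul_const, (hX j).integral_cexp hT hint hpos hf hB, ← Complex.exp_add,
      integral_sub h1 h2, integral_mul_const, integral_complex_ofReal, sub_eq_add_neg]
  have hind : iIndepFun (fun (j : ℕ) ω => compensatedIntegral Λ f (X j ω)) P :=
    hindep.comp (fun _ => compensatedIntegral Λ f) fun _ => measurable_compensatedIntegral Λ hf
  have h := congrFun ((hind.restrict _).charFun_map_fun_finsetSum_eq_prod (s := S)
    fun j _ => (hm j).aemeasurable) 1
  rw [charFun_apply, integral_map (Finset.measurable_fun_sum _ fun j _ => hm j).aemeasurable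
    (by fun_prop), Finset.prod_apply] at h
  simp only [Real.inner_apply, mul_one] at h
  rw [h, Complex.exp_nat_mul, ← Finset.prod_const]
  refine Finset.prod_congr rfl fun j _ => ?_
  rw [charFun_apply, integral_map (hm j).aemeasurable (by fun_prop)]
  simpa using hone j

/-- The exponent `w` of the characteristic function has nonpositive real part, as `cos ≤ 1`, so
`|e^w - 1| ≤ |w|`, which is quadratic in `s`. The factor `2` over the true variance comes from the
crude bound `|e^{ix} - 1 - ix| ≤ x²`. -/
lemma lintegral_sq_sum_compensatedIntegral_le (hX : ∀ j, IsPoissonProcess P T lam (X j))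
    (hindep : iIndepFun X P) (hT : MeasurableSet T) (hint : IntegrableOn lam T)
    (hpos : ∀ t ∈ T, 0 ≤ lam t) {f : ℝ → ℝ} (hf : Measurable f) {B : ℝ} (hB : ∀ t, ‖f t‖ ≤ B)
    (S : Finset ℕ) :
    ∫⁻ ω, ENNReal.ofReal
        ((∑ j ∈ S, compensatedIntegral (intensityMeasure T lam) f (X j ω)) ^ 2) ∂P ≤
      ENNReal.ofReal (2 * (S.card * ∫ t, f t ^ 2 ∂(intensityMeasure T lam))) := by
  have := isFiniteMeasure_intensityMeasure hint
  set Λ := intensityMeasure T lam with hΛ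
  refine lintegral_sq_le_of_norm_charFun_sub_one_le (Finset.measurable_fun_sum _ fun j _ =>
    (measurable_compensatedIntegral Λ hf).comp (hX j).measurable) fun s => ?_
  have hfs : Measurable fun t => s * f t := hf.const_mul s
  have hBs (t : ℝ) : ‖s * f t‖ ≤ |s| * B := by
    rw [norm_mul, Real.norm_eq_abs]
    gcongr
    exact hB t
  have h1 (x : Measure ℝ) : compensatedIntegral Λ (fun t => s * f t) x =
      s * compensatedIntegral Λ f x := by
    simp only [compensatedIntegral, integral_const_mul, mul_sub]
  have h2 := integral_cexp_sum_compensatedIntegral hX hindep hT hint hpos hfs hBs S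
  simp only [← hΛ, h1, ← Finset.mul_sum] at h2
  simp only [Function.comp_apply]
  rw [h2]
  have hexp : Integrable (fun t => Complex.exp ((s * f t : ℝ) * Complex.I) - 1 -
      (s * f t : ℝ) * Complex.I) Λ :=
    (((Integrable.of_bound (C := 1) (Measurable.aestronglyMeasurable (by fun_prop))
        (ae_of_all _ fun ω => (Complex.norm_exp_ofReal_mul_I _).le)).sub (integrable_const _)).sub
      ((Integrable.of_bound hfs.aestronglyMeasurable _ (ae_of_all _ hBs)).ofReal.mul_const _))
  refine (Complex.norm_exp_sub_one_le_of_re_nonpos ?_).trans ?_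
  · rw [← Complex.ofReal_natCast, Complex.re_ofReal_mul, ← RCLike.re_eq_complex_re,
      ← integral_re hexp]
    refine mul_nonpos_of_nonneg_of_nonpos (by positivity) (integral_nonpos fun t => ?_)
    have h3 := Complex.exp_ofReal_mul_I_re (s * f t)
    simp only [RCLike.re_eq_complex_re, Complex.sub_re, h3, Complex.one_re,
      Complex.re_ofReal_mul, Complex.I_re, mul_zero, sub_zero, Pi.zero_apply]
    linarith [Real.cos_le_one (s * f t)]
  · rw [norm_mul, Complex.norm_natCast, mul_left_comm, ← integral_const_mul]
    gcongr
    refine norm_integral_le_of_norm_le ?_ (ae_of_all _ fun t => ?_)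
    · exact (Integrable.of_bound (C := B ^ 2) (hf.pow_const 2).aestronglyMeasurable
        (ae_of_all _ fun t => by rw [norm_pow]; gcongr; exact hB t)).const_mul _
    · rw [← mul_pow]
      exact norm_cexp_mul_I_sub_one_sub_le _

variable {d : ℕ}

lemma lintegral_norm_sq_sum_compensatedIntegral_le (hX : ∀ j, IsPoissonProcess P T lam (X j))
    (hindep : iIndepFun X P) (hT : MeasurableSet T) (hint : IntegrableOn lam T)
    (hpos : ∀ t ∈ T, 0 ≤ lam t) {f : ℝ → EuclideanSpace ℝ (Fin d)} (hf : Measurable f) {B : ℝ}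
    (hB : ∀ t, ‖f t‖ ≤ B) (S : Finset ℕ) :
    ∫⁻ ω, ENNReal.ofReal
        (‖∑ j ∈ S, compensatedIntegral (intensityMeasure T lam) f (X j ω)‖ ^ 2) ∂P ≤
      ENNReal.ofReal (2 * (S.card * ∫ t, ‖f t‖ ^ 2 ∂(intensityMeasure T lam))) := by
  have := isFiniteMeasure_intensityMeasure hint
  set Λ := intensityMeasure T lam with hΛ
  have hfm (i : Fin d) : Measurable fun t => f t i := by fun_prop
  have hfB (i : Fin d) (t : ℝ) : ‖f t i‖ ≤ B := (PiLp.norm_apply_le (f t) i).trans (hB t)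
  have hfi (i : Fin d) : Integrable (fun t => f t i ^ 2) Λ :=
    Integrable.of_bound (C := B ^ 2) ((hfm i).pow_const 2).aestronglyMeasurable
        (ae_of_all _ fun t => by rw [norm_pow]; gcongr; exact hfB i t)
  have hcoord (i : Fin d) (ω : Ω) : (∑ j ∈ S, compensatedIntegral Λ f (X j ω)) i =
      ∑ j ∈ S, compensatedIntegral Λ (fun t => f t i) (X j ω) := by
    have h (x : Measure ℝ) := (EuclideanSpace.proj (𝕜 := ℝ) i).compensatedIntegral_comp Λ hf hB x
    change EuclideanSpace.proj (𝕜 := ℝ) i (∑ j ∈ S, compensatedIntegral Λ f (X j ω)) = _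
    rw [map_sum]
    exact Finset.sum_congr rfl fun j _ => (h (X j ω)).symm
  simp only [EuclideanSpace.real_norm_sq_eq, hcoord]
  rw [integral_finsetSum _ fun i _ => hfi i, Finset.mul_sum, Finset.mul_sum,
    ENNReal.ofReal_sum_of_nonneg fun i _ => by positivity]
  simp only [ENNReal.ofReal_sum_of_nonneg fun i _ => sq_nonneg _]
  rw [lintegral_finsetSum _ fun i _ => ?_]
  · exact Finset.sum_le_sum fun i _ =>
      lintegral_sq_sum_compensatedIntegral_le hX hindep hT hint hpos (hfm i) (hfB i) S
  · exact ((Finset.measurable_fun_sum _ fun j _ =>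
      (measurable_compensatedIntegral Λ (hfm i)).comp (hX j).measurable).pow_const 2).ennreal_ofReal

end Sums

/-! ### Central limit theorem for compensated integrals -/

/-- Second-order Taylor expansion at `y = x/√n`: the cubic remainder, multiplied by `n`, is of order
`1/√n`. -/
lemma tendsto_natCast_mul_cexp_sub (x : ℝ) :
    Tendsto (fun n : ℕ => (n : ℂ) * (Complex.exp (((√(n : ℝ))⁻¹ * x : ℝ) * Complex.I) - 1 -
      ((√(n : ℝ))⁻¹ * x : ℝ) * Complex.I)) atTop (𝓝 (-(x ^ 2 / 2 : ℝ))) := by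
  rw [tendsto_iff_norm_sub_tendsto_zero]
  have hlim : Tendsto (fun n : ℕ => |x| ^ 3 * Real.exp |x| * (√(n : ℝ))⁻¹) atTop (𝓝 0) := by
    have := (tendsto_inv_atTop_zero.comp (Real.tendsto_sqrt_atTop.comp
      tendsto_natCast_atTop_atTop)).const_mul (|x| ^ 3 * Real.exp |x|)
    simpa using this
  refine squeeze_zero' (Eventually.of_forall fun _ => norm_nonneg _) ?_ hlim
  filter_upwards [eventually_ge_atTop 1] with n hn
  have hn' : (1 : ℝ) ≤ n := by exact_mod_cast hn
  have hs : 1 ≤ √(n : ℝ) := Real.one_le_sqrt.2 hn'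
  have hs0 : √(n : ℝ) ≠ 0 := by positivity
  have hsq : √(n : ℝ) ^ 2 = n := Real.sq_sqrt (by positivity)
  set y : ℝ := (√(n : ℝ))⁻¹ * x with hy
  have hny : (n : ℝ) * y ^ 2 = x ^ 2 := by
    rw [hy, mul_pow, inv_pow, hsq, mul_inv_cancel_left₀ (by positivity)]
  have hyx : |y| ≤ |x| := by
    rw [hy, abs_mul, abs_of_nonneg (by positivity)]
    exact mul_le_of_le_one_left (abs_nonneg _) (inv_le_one_of_one_le₀ hs)
  have e : (n : ℂ) * (Complex.exp (y * Complex.I) - 1 - y * Complex.I) - -((x ^ 2 / 2 : ℝ) : ℂ) =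
      n * (Complex.exp (y * Complex.I) -
        ∑ m ∈ Finset.range 3, (y * Complex.I) ^ m / (m.factorial : ℂ)) := by
    rw [← hny]
    simp only [Finset.sum_range_succ, Finset.sum_range_zero, mul_pow, Complex.I_sq]
    push_cast
    norm_num [Nat.factorial]
    ring
  rw [e, norm_mul, Complex.norm_natCast]
  have h3 := Complex.norm_exp_sub_sum_le_norm_mul_exp (y * Complex.I) 3
  rw [norm_mul, Complex.norm_I, mul_one, Complex.norm_real, Real.norm_eq_abs] at h3
  calc (n : ℝ) * ‖Complex.exp (y * Complex.I) -
        ∑ m ∈ Finset.range 3, (y * Complex.I) ^ m / (m.factorial : ℂ)‖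
      ≤ n * (|y| ^ 3 * Real.exp |x|) := by
        gcongr
        exact h3.trans (by gcongr)
    _ = |x| ^ 3 * Real.exp |x| * (√(n : ℝ))⁻¹ := by
        rw [hy, abs_mul, abs_of_nonneg (by positivity : 0 ≤ (√(n : ℝ))⁻¹)]
        nth_rewrite 1 [← hsq]
        field_simp

lemma tendsto_natCast_mul_integral_cexp_sub (Λ : Measure ℝ) [IsFiniteMeasure Λ] {a : ℝ → ℝ}
    (ha : Measurable a) {B : ℝ} (hB : ∀ t, ‖a t‖ ≤ B) :
    Tendsto (fun n : ℕ => (n : ℂ) * ∫ t, (Complex.exp (((√(n : ℝ))⁻¹ * a t : ℝ) * Complex.I) - 1 -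
      ((√(n : ℝ))⁻¹ * a t : ℝ) * Complex.I) ∂Λ) atTop (𝓝 (-((∫ t, a t ^ 2 ∂Λ) / 2 : ℝ))) := by
  have e : (-((∫ t, a t ^ 2 ∂Λ) / 2 : ℝ) : ℂ) = ∫ t, -((a t ^ 2 / 2 : ℝ) : ℂ) ∂Λ := by
    rw [integral_neg, integral_complex_ofReal, integral_div]
  rw [e]
  simp only [← integral_const_mul]
  have hi : Integrable (fun t => a t ^ 2) Λ :=
    Integrable.of_bound (C := B ^ 2) (ha.pow_const 2).aestronglyMeasurable
      (ae_of_all _ fun t => by rw [norm_pow]; gcongr; exact hB t)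
  -- The bound `x²` at `x = a/√n`, multiplied by `n`, is `a²` for every positive `n`, which gives an
  -- integrable dominating function.
  refine tendsto_integral_of_dominated_convergence (fun t => a t ^ 2) (fun n => ?_) hi
    (fun n => ae_of_all _ fun t => ?_) (ae_of_all _ fun t => tendsto_natCast_mul_cexp_sub (a t))
  · exact Measurable.aestronglyMeasurable (by fun_prop)
  · rw [norm_mul, Complex.norm_natCast]
    rcases n.eq_zero_or_pos with rfl | hn
    · simpa using sq_nonneg (a t)
    have hn' : (n : ℝ) ≠ 0 := by exact_mod_cast hn.ne'
    calc (n : ℝ) * _ ≤ n * ((√(n : ℝ))⁻¹ * a t) ^ 2 := by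
          gcongr
          exact norm_cexp_mul_I_sub_one_sub_le _
      _ = a t ^ 2 := by
          rw [mul_pow, inv_pow, Real.sq_sqrt (by positivity), mul_inv_cancel_left₀ hn']

/-- The central limit theorem for compensated integrals against independent Poisson processes. -/
theorem tendstoInDistribution_sum_compensatedIntegral {Ω : Type*} [MeasurableSpace Ω]
    {P : Measure Ω} [IsProbabilityMeasure P] {T : Set ℝ} {lam : ℝ → ℝ} {X : ℕ → Ω → Measure ℝ}
    (hX : ∀ j, IsPoissonProcess P T lam (X j))
    (hindep : iIndepFun X P) (hT : MeasurableSet T) (hint : IntegrableOn lam T)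
    (hpos : ∀ t ∈ T, 0 ≤ lam t) {d : ℕ} {f : ℝ → EuclideanSpace ℝ (Fin d)} (hf : Measurable f)
    {B : ℝ} (hB : ∀ t, ‖f t‖ ≤ B) {S : Matrix (Fin d) (Fin d) ℝ} (hS : S.PosSemidef)
    (hcov : ∀ u : EuclideanSpace ℝ (Fin d), u.ofLp ⬝ᵥ S.mulVec u.ofLp =
      ∫ t, inner ℝ u (f t) ^ 2 ∂(intensityMeasure T lam)) :
    TendstoInDistribution (fun (n : ℕ) ω => (√(n : ℝ))⁻¹ • ∑ j ∈ Finset.range n,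
      compensatedIntegral (intensityMeasure T lam) f (X j ω)) atTop id (fun _ => P)
      (multivariateGaussian 0 S) := by
  have := isFiniteMeasure_intensityMeasure hint
  set Λ := intensityMeasure T lam with hΛ
  have hm (n : ℕ) : Measurable fun ω => (√(n : ℝ))⁻¹ • ∑ j ∈ Finset.range n,
      compensatedIntegral Λ f (X j ω) := by
    have := Finset.measurable_fun_sum (Finset.range n) fun j _ =>
      (measurable_compensatedIntegral Λ hf).comp (hX j).measurable
    exact this.const_smul (√(n : ℝ))⁻¹
  refine ⟨fun n => (hm n).aemeasurable, aemeasurable_id, ?_⟩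
  -- Lévy's continuity theorem. The hypothesis `hcov` identifies the Gaussian quadratic form with
  -- the variance of the projected integral.
  refine ProbabilityMeasure.tendsto_iff_tendsto_charFun.2 fun u => ?_
  simp only [ProbabilityMeasure.coe_mk, Measure.map_id]
  rw [charFun_multivariateGaussian hS, hcov u]
  have hfu : Measurable fun t => inner ℝ u (f t) := by fun_prop
  have hBu (t : ℝ) : ‖inner ℝ u (f t)‖ ≤ ‖u‖ * B :=
    (norm_inner_le_norm _ _).trans (by gcongr; exact hB t)
  have hchar (n : ℕ) : charFun (P.map fun ω => (√(n : ℝ))⁻¹ • ∑ j ∈ Finset.range n,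
      compensatedIntegral Λ f (X j ω)) u = Complex.exp ((n : ℂ) *
        ∫ t, (Complex.exp (((√(n : ℝ))⁻¹ * inner ℝ u (f t) : ℝ) * Complex.I) - 1 -
          ((√(n : ℝ))⁻¹ * inner ℝ u (f t) : ℝ) * Complex.I) ∂Λ) := by
    have h := integral_cexp_sum_compensatedIntegral hX hindep hT hint hpos
      (hfu.const_mul (√(n : ℝ))⁻¹) (B := (√(n : ℝ))⁻¹ * (‖u‖ * B)) (fun t => by
        rw [norm_mul, Real.norm_of_nonneg (by positivity)]
        gcongr
        exact hBu t) (Finset.range n)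
    rw [Finset.card_range] at h
    rw [← h, charFun_apply, integral_map (hm n).aemeasurable (by fun_prop)]
    refine integral_congr_ae (ae_of_all _ fun ω => ?_)
    have hc (x : Measure ℝ) := ((√(n : ℝ))⁻¹ • innerSL ℝ u).compensatedIntegral_comp Λ hf hB x
    simp only [smul_apply, innerSL_apply_apply, smul_eq_mul] at hc
    simp only [← hΛ, hc]
    rw [real_inner_comm, inner_smul_right, inner_sum, Finset.mul_sum]
  simp only [hchar]
  refine (Complex.continuous_exp.tendsto _).comp ?_
  have h := tendsto_natCast_mul_integral_cexp_sub Λ hfu hBu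
  convert h using 2
  push_cast
  simp

/-! ### Growth of the learning sample -/

section LearningSize

variable {δ : ℝ}

lemma learningSize_le_rpow (δ : ℝ) (n : ℕ) : (learningSize δ n : ℝ) ≤ (n : ℝ) ^ δ :=
  Nat.floor_le (by positivity)

lemma learningSize_le (hδ : δ ≤ 1) {n : ℕ} (hn : 1 ≤ n) : learningSize δ n ≤ n := by
  have hn' : (1 : ℝ) ≤ n := by exact_mod_cast hn
  have h := (learningSize_le_rpow δ n).trans (Real.rpow_le_rpow_of_exponent_le hn' hδ)
  rw [Real.rpow_one] at h
  exact_mod_cast h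

lemma tendsto_learningSize (hδ : 0 < δ) : Tendsto (learningSize δ) atTop atTop :=
  tendsto_nat_floor_atTop.comp ((tendsto_rpow_atTop hδ).comp tendsto_natCast_atTop_atTop)

/-- The use of `δ < 1`: the learning observations are a negligible fraction of all. -/
lemma tendsto_learningSize_div (hδ : δ < 1) :
    Tendsto (fun n : ℕ => (learningSize δ n : ℝ) / n) atTop (𝓝 0) := by
  have hlim : Tendsto (fun n : ℕ => (n : ℝ) ^ (-(1 - δ))) atTop (𝓝 0) :=
    (tendsto_rpow_neg_atTop (sub_pos.2 hδ)).comp tendsto_natCast_atTop_atTop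
  refine squeeze_zero' (Eventually.of_forall fun _ => by positivity) ?_ hlim
  filter_upwards [eventually_ge_atTop 1] with n hn
  have hn' : (0 : ℝ) < n := by exact_mod_cast hn
  rw [neg_sub, Real.rpow_sub hn', Real.rpow_one]
  gcongr
  exact learningSize_le_rpow δ n

/-- The use of `δ > 1/2`: the squared preliminary error, of order `1/N`, stays negligible after
multiplication by `√n`. -/
lemma tendsto_sqrt_div_learningSize (hδ : 1 / 2 < δ) :
    Tendsto (fun n : ℕ => √(n : ℝ) / learningSize δ n) atTop (𝓝 0) := by
  have hlim : Tendsto (fun n : ℕ => 2 * (n : ℝ) ^ (-(δ - 1 / 2))) atTop (𝓝 0) := by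
    simpa using ((tendsto_rpow_neg_atTop (sub_pos.2 hδ)).comp
      tendsto_natCast_atTop_atTop).const_mul 2
  refine squeeze_zero' (Eventually.of_forall fun _ => by positivity) ?_ hlim
  have hbig := ((tendsto_rpow_atTop (by linarith : 0 < δ)).comp
    tendsto_natCast_atTop_atTop).eventually_ge_atTop (2 : ℝ)
  filter_upwards [eventually_ge_atTop 1, hbig] with n hn hn2
  have hn' : (0 : ℝ) < n := by exact_mod_cast hn
  simp only [Function.comp_apply] at hn2
  -- Rounding down loses less than `1`, which is at most half of `n ^ δ` once `n ^ δ ≥ 2`.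
  have h1 : (n : ℝ) ^ δ / 2 ≤ learningSize δ n := by
    have := Nat.sub_one_lt_floor ((n : ℝ) ^ δ)
    simp only [learningSize]
    linarith
  rw [neg_sub, Real.rpow_sub hn', ← Real.sqrt_eq_rpow]
  calc √(n : ℝ) / learningSize δ n ≤ √(n : ℝ) / ((n : ℝ) ^ δ / 2) := by gcongr
    _ = 2 * (√(n : ℝ) / (n : ℝ) ^ δ) := by field_simp

end LearningSize

/-! ### Convergence in probability -/

section Probability

variable {Ω : Type*} [MeasurableSpace Ω] {P : Measure Ω}

lemma tendsto_measure_of_lintegral_sq_tendsto {F : Type*} [NormedAddCommGroup F]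
    [MeasurableSpace F] [BorelSpace F] {Y : ℕ → Ω → F} (hY : ∀ n, AEMeasurable (Y n) P)
    (h : Tendsto (fun n => ∫⁻ ω, ENNReal.ofReal (‖Y n ω‖ ^ 2) ∂P) atTop (𝓝 0)) {ε : ℝ}
    (hε : 0 < ε) : Tendsto (fun n => P {ω | ε ≤ ‖Y n ω‖}) atTop (𝓝 0) := by
  have h0 : ENNReal.ofReal (ε ^ 2) ≠ 0 := by simp [hε.ne']
  have hlim : Tendsto (fun n => (∫⁻ ω, ENNReal.ofReal (‖Y n ω‖ ^ 2) ∂P) / ENNReal.ofReal (ε ^ 2))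
      atTop (𝓝 0) := by
    simpa using ENNReal.Tendsto.div_const h (Or.inr h0)
  refine tendsto_of_tendsto_of_tendsto_of_le_of_le tendsto_const_nhds hlim
    (fun _ => zero_le) fun n => ?_
  refine le_trans (measure_mono fun ω hω => ?_) (meas_ge_le_lintegral_div
    ((hY n).norm.pow_const 2).ennreal_ofReal h0 ENNReal.ofReal_ne_top)
  have hω' : ε ≤ ‖Y n ω‖ := hω
  exact ENNReal.ofReal_le_ofReal (by gcongr)

/-- If `W n` is bounded in probability and `s n → 0`, then `s n * W n ^ p → 0` in probability. -/
lemma tendsto_measure_mul_pow_of_bounded {W : ℕ → Ω → ℝ} (hW0 : ∀ n ω, 0 ≤ W n ω)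
    (hW : ∀ ε : ℝ, 0 < ε → ∃ M : ℝ, ∀ n, P {ω | M < W n ω} ≤ ENNReal.ofReal ε) {s : ℕ → ℝ}
    (hs0 : ∀ n, 0 ≤ s n) (hs : Tendsto s atTop (𝓝 0)) (p : ℕ) {ε : ℝ} (hε : 0 < ε) :
    Tendsto (fun n => P {ω | ε ≤ s n * W n ω ^ p}) atTop (𝓝 0) := by
  rw [ENNReal.tendsto_atTop_zero]
  intro η hη
  obtain ⟨r, hr0, hr⟩ : ∃ r : ℝ, 0 < r ∧ ENNReal.ofReal r ≤ η := by
    rcases eq_or_ne η ∞ with rfl | hη'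
    · exact ⟨1, one_pos, le_top⟩
    · exact ⟨η.toReal, ENNReal.toReal_pos hη.ne' hη', ENNReal.ofReal_toReal_le⟩
  obtain ⟨M, hM⟩ := hW r hr0
  have hlim : Tendsto (fun n => s n * |M| ^ p) atTop (𝓝 0) := by simpa using hs.mul_const (|M| ^ p)
  obtain ⟨n₀, hn₀⟩ := eventually_atTop.1 (hlim.eventually_lt_const hε)
  refine ⟨n₀, fun n hn => (measure_mono fun ω hω => ?_).trans ((hM n).trans hr)⟩
  have hω' : ε ≤ s n * W n ω ^ p := hω
  change M < W n ω
  by_contra! hle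
  have h1 : W n ω ^ p ≤ |M| ^ p := pow_le_pow_left₀ (hW0 n ω) (hle.trans (le_abs_self M)) p
  exact absurd (hω'.trans (mul_le_mul_of_nonneg_left h1 (hs0 n))) (not_le.2 (hn₀ n hn))

/-- Near `y` the integrand is below `ε`, and elsewhere it is at most `C` on an event of vanishing
probability. -/
lemma tendsto_lintegral_of_tendstoInMeasure_const [IsProbabilityMeasure P] {F : Type*}
    [NormedAddCommGroup F] [MeasurableSpace F] [BorelSpace F] {Y : ℕ → Ω → F}
    (hY : ∀ n, Measurable (Y n)) {y : F}
    (hlim : ∀ ε : ℝ, 0 < ε → Tendsto (fun n => P {ω | ε ≤ ‖Y n ω - y‖}) atTop (𝓝 0))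
    {h : F → ℝ} {C : ℝ} (hC : ∀ z, h z ≤ C) (hh : Tendsto h (𝓝 y) (𝓝 0)) :
    Tendsto (fun n => ∫⁻ ω, ENNReal.ofReal (h (Y n ω)) ∂P) atTop (𝓝 0) := by
  have key (ε : ℝ) (hε : 0 < ε) : ∃ u : ℕ → ℝ≥0∞, Tendsto u atTop (𝓝 (ENNReal.ofReal ε)) ∧
      ∀ n, ∫⁻ ω, ENNReal.ofReal (h (Y n ω)) ∂P ≤ u n := by
    obtain ⟨r, hr, hr'⟩ := Metric.eventually_nhds_iff.1 (hh.eventually_lt_const hε)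
    refine ⟨fun n => ENNReal.ofReal ε + ENNReal.ofReal C * P {ω | r ≤ ‖Y n ω - y‖}, ?_, fun n => ?_⟩
    · have := (ENNReal.Tendsto.const_mul (a := ENNReal.ofReal C) (hlim r hr)
        (Or.inr ENNReal.ofReal_ne_top)).const_add (ENNReal.ofReal ε)
      simpa using this
    · have hs : MeasurableSet {ω | r ≤ ‖Y n ω - y‖} := by
        have h1 : Measurable fun ω => ‖Y n ω - y‖ :=
          ((by fun_prop : Continuous fun z : F => ‖z - y‖).measurable).comp (hY n)
        exact measurableSet_le measurable_const h1
      calc ∫⁻ ω, ENNReal.ofReal (h (Y n ω)) ∂P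
          ≤ ∫⁻ ω, (ENNReal.ofReal ε +
              {ω | r ≤ ‖Y n ω - y‖}.indicator (fun _ => ENNReal.ofReal C) ω) ∂P := by
            refine lintegral_mono fun ω => ?_
            by_cases hω : r ≤ ‖Y n ω - y‖
            · rw [indicator_of_mem (show ω ∈ {ω | r ≤ ‖Y n ω - y‖} from hω)]
              exact (ENNReal.ofReal_le_ofReal (hC _)).trans le_add_self
            · refine le_trans (ENNReal.ofReal_le_ofReal (hr' ?_).le) le_self_add
              rw [dist_eq_norm]
              exact not_le.1 hω
        _ = ENNReal.ofReal ε + ENNReal.ofReal C * P {ω | r ≤ ‖Y n ω - y‖} := by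
            rw [lintegral_add_left measurable_const, lintegral_const, measure_univ, mul_one,
              lintegral_indicator_const hs]
  rw [ENNReal.tendsto_atTop_zero]
  intro η hη
  obtain ⟨r, hr0, hr⟩ : ∃ r : ℝ, 0 < r ∧ ENNReal.ofReal r < η := by
    obtain ⟨q, hq0, hq⟩ := ENNReal.lt_iff_exists_nnreal_btwn.1 hη
    exact ⟨q, by exact_mod_cast hq0, by simpa using hq⟩
  obtain ⟨u, hu, hu'⟩ := key r hr0
  obtain ⟨n₀, hn₀⟩ := eventually_atTop.1 (hu.eventually_lt_const hr)
  exact ⟨n₀, fun n hn => (hu' n).trans (hn₀ n hn).le⟩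

end Probability

/-! ### Integrands with an independent random parameter -/

section RandomParameter

variable {E F : Type*} [MeasurableSpace E] [NormedAddCommGroup F] [NormedSpace ℝ F]
  [MeasurableSpace F] [BorelSpace F] [SecondCountableTopology F]

lemma measurable_integral_finitePart_prod {g : E → ℝ → F}
    (hg : Measurable (Function.uncurry g)) :
    Measurable fun p : E × Measure ℝ => ∫ t, g p.1 t ∂(finitePart p.2) :=
  (StronglyMeasurable.integral_kernel_prod_right' (κ := Kernel.prodMkLeft E finitePart)
    (f := fun p : (E × Measure ℝ) × ℝ => g p.1.1 p.2)
    (hg.comp ((measurable_fst.comp measurable_fst).prodMk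
      measurable_snd)).stronglyMeasurable).measurable

lemma measurable_integral_param (Λ : Measure ℝ) [SFinite Λ] {g : E → ℝ → F}
    (hg : Measurable (Function.uncurry g)) : Measurable fun θ => ∫ t, g θ t ∂Λ :=
  (hg.stronglyMeasurable.integral_prod_right (ν := Λ)).measurable

lemma measurable_compensatedIntegral_prod (Λ : Measure ℝ) [SFinite Λ] {g : E → ℝ → F}
    (hg : Measurable (Function.uncurry g)) :
    Measurable fun p : E × Measure ℝ => compensatedIntegral Λ (g p.1) p.2 :=
  (measurable_integral_finitePart_prod hg).sub
    ((measurable_integral_param Λ hg).comp measurable_fst)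

/-- The second moment bound when the integrand depends on an independent random parameter. -/
lemma lintegral_norm_sq_sum_compensatedIntegral_param_le {Ω : Type*} [MeasurableSpace Ω]
    {P : Measure Ω} [IsProbabilityMeasure P] {T : Set ℝ} {lam : ℝ → ℝ} {X : ℕ → Ω → Measure ℝ}
    (hX : ∀ j, IsPoissonProcess P T lam (X j))
    (hindep : iIndepFun X P) (hT : MeasurableSet T) (hint : IntegrableOn lam T)
    (hpos : ∀ t ∈ T, 0 ≤ lam t) {d : ℕ} {g : E → ℝ → EuclideanSpace ℝ (Fin d)}
    (hg : Measurable (Function.uncurry g)) {B : ℝ} (hB : ∀ θ t, ‖g θ t‖ ≤ B) (S : Finset ℕ)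
    {U : Ω → E} (hU : Measurable U) (hUX : IndepFun U (fun ω (j : S) => X j ω) P) :
    ∫⁻ ω, ENNReal.ofReal
        (‖∑ j ∈ S, compensatedIntegral (intensityMeasure T lam) (g (U ω)) (X j ω)‖ ^ 2) ∂P ≤
      ∫⁻ ω, ENNReal.ofReal (2 * (S.card * ∫ t, ‖g (U ω) t‖ ^ 2 ∂(intensityMeasure T lam))) ∂P := by
  have := isFiniteMeasure_intensityMeasure hint
  set Λ := intensityMeasure T lam with hΛ
  have hXS : Measurable fun ω (j : S) => X j ω := measurable_pi_lambda _ fun j => (hX j).measurable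
  have hH : Measurable fun p : E × (S → Measure ℝ) =>
      ENNReal.ofReal (‖∑ j : S, compensatedIntegral Λ (g p.1) (p.2 j)‖ ^ 2) := by
    have h1 (j : S) : Measurable fun p : E × (S → Measure ℝ) =>
        compensatedIntegral Λ (g p.1) (p.2 j) :=
      (measurable_compensatedIntegral_prod Λ hg).comp
        (measurable_fst.prodMk ((measurable_pi_apply j).comp measurable_snd))
    have h2 := Finset.measurable_fun_sum (Finset.univ : Finset S) fun j _ => h1 j
    fun_prop
  have hsum (θ : E) (ω : Ω) : ∑ j ∈ S, compensatedIntegral Λ (g θ) (X j ω) =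
      ∑ j : S, compensatedIntegral Λ (g θ) (X j ω) := (Finset.sum_coe_sort S _).symm
  have hh : Measurable fun θ => ENNReal.ofReal (2 * (S.card * ∫ t, ‖g θ t‖ ^ 2 ∂Λ)) := by
    have h1 : Measurable (Function.uncurry fun θ t => ‖g θ t‖ ^ 2) := hg.norm.pow_const 2
    have := measurable_integral_param Λ h1
    fun_prop
  calc ∫⁻ ω, ENNReal.ofReal (‖∑ j ∈ S, compensatedIntegral Λ (g (U ω)) (X j ω)‖ ^ 2) ∂P
      = ∫⁻ p, ENNReal.ofReal (‖∑ j : S, compensatedIntegral Λ (g p.1) (p.2 j)‖ ^ 2)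
          ∂(P.map fun ω => (U ω, fun j : S => X j ω)) := by
        rw [lintegral_map hH (hU.prodMk hXS)]
        simp only [hsum]
    _ = ∫⁻ θ, ∫⁻ x, ENNReal.ofReal (‖∑ j : S, compensatedIntegral Λ (g θ) (x j)‖ ^ 2)
          ∂(P.map fun ω (j : S) => X j ω) ∂(P.map U) := by
        have : IsProbabilityMeasure (P.map fun ω (j : S) => X j ω) :=
          Measure.isProbabilityMeasure_map hXS.aemeasurable
        -- By independence the joint law is a product, so for frozen `θ` the inner integral falls
        -- under the bound for deterministic integrands.
        rw [hUX.map_prod_eq_prod_map_map hU.aemeasurable hXS.aemeasurable,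
          lintegral_prod _ hH.aemeasurable]
    _ ≤ ∫⁻ θ, ENNReal.ofReal (2 * (S.card * ∫ t, ‖g θ t‖ ^ 2 ∂Λ)) ∂(P.map U) := by
        refine lintegral_mono fun θ => ?_
        have hθ := hH.comp (measurable_prodMk_left (x := θ))
        simp only [Function.comp_def] at hθ
        rw [lintegral_map hθ hXS]
        simp only [← hsum]
        exact lintegral_norm_sq_sum_compensatedIntegral_le hX hindep hT hint hpos
          (hg.comp measurable_prodMk_left) (hB θ) S
    _ = _ := lintegral_map hh hU

end RandomParameter

/-! ### Asymptotic normality of an abstract one-step estimator -/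

lemma compensatedIntegral_sub {F : Type*} [NormedAddCommGroup F] [NormedSpace ℝ F]
    [MeasurableSpace F] [BorelSpace F] [SecondCountableTopology F] (Λ : Measure ℝ)
    [IsFiniteMeasure Λ] {f g : ℝ → F} (hf : Measurable f) (hg : Measurable g) {B : ℝ}
    (hfB : ∀ t, ‖f t‖ ≤ B) (hgB : ∀ t, ‖g t‖ ≤ B) (x : Measure ℝ) :
    compensatedIntegral Λ (fun t => f t - g t) x =
      compensatedIntegral Λ f x - compensatedIntegral Λ g x := by
  have hi {f : ℝ → F} (hf : Measurable f) (hfB : ∀ t, ‖f t‖ ≤ B) (μ : Measure ℝ)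
      [IsFiniteMeasure μ] : Integrable f μ :=
    Integrable.of_bound hf.aestronglyMeasurable B (ae_of_all _ hfB)
  simp only [compensatedIntegral]
  rw [integral_sub (hi hf hfB _) (hi hg hgB _), integral_sub (hi hf hfB _) (hi hg hgB _)]
  abel

lemma lintegral_norm_sq_inv_sqrt_smul_le {Ω F : Type*} [MeasurableSpace Ω] [NormedAddCommGroup F]
    [NormedSpace ℝ F] {P : Measure Ω} {Y : Ω → F} {n m : ℕ} {h : Ω → ℝ} {C : ℝ}
    (hC : (m : ℝ) / n ≤ C) (hh : ∀ ω, 0 ≤ h ω)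
    (hY : ∫⁻ ω, ENNReal.ofReal (‖Y ω‖ ^ 2) ∂P ≤ ∫⁻ ω, ENNReal.ofReal (2 * (m * h ω)) ∂P) :
    ∫⁻ ω, ENNReal.ofReal (‖(√(n : ℝ))⁻¹ • Y ω‖ ^ 2) ∂P ≤
      ∫⁻ ω, ENNReal.ofReal (2 * (C * h ω)) ∂P := by
  have e (ω : Ω) : ENNReal.ofReal (‖(√(n : ℝ))⁻¹ • Y ω‖ ^ 2) =
      ENNReal.ofReal (n : ℝ)⁻¹ * ENNReal.ofReal (‖Y ω‖ ^ 2) := by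
    rw [← ENNReal.ofReal_mul (by positivity), norm_smul, mul_pow,
      Real.norm_of_nonneg (by positivity), inv_pow, Real.sq_sqrt (by positivity)]
  simp only [e]
  rw [lintegral_const_mul' _ _ ENNReal.ofReal_ne_top]
  refine (mul_le_mul_right hY _).trans ?_
  rw [← lintegral_const_mul' _ _ ENNReal.ofReal_ne_top]
  refine lintegral_mono fun ω => ?_
  simp only
  rw [← ENNReal.ofReal_mul (by positivity)]
  refine ENNReal.ofReal_le_ofReal ?_
  calc (n : ℝ)⁻¹ * (2 * (m * h ω)) = 2 * (m / n * h ω) := by ring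
    _ ≤ 2 * (C * h ω) := by
        have := hh ω
        gcongr

section OneStep

variable {Ω : Type*} [MeasurableSpace Ω] {P : Measure Ω} {T : Set ℝ} {lam : ℝ → ℝ}
  {X : ℕ → Ω → Measure ℝ} {d : ℕ}
  {est : (n : ℕ) → (Fin n → Measure ℝ) → EuclideanSpace ℝ (Fin d)}

lemma measurable_evalFirst (hX : ∀ j, Measurable (X j)) (hest : ∀ n, Measurable (est n)) (n : ℕ) :
    Measurable fun ω => evalFirst est n fun j => X j ω :=
  (hest n).comp (measurable_pi_lambda _ fun j => hX j)

/-- Sample splitting: the preliminary estimator and the correction use disjoint blocks of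
observations. -/
lemma indepFun_evalFirst (hX : ∀ j, Measurable (X j)) (hindep : iIndepFun X P)
    (hest : ∀ n, Measurable (est n)) (N n : ℕ) :
    IndepFun (fun ω => evalFirst est N fun j => X j ω)
      (fun ω (j : Finset.Ico N n) => X j ω) P := by
  have hdisj : Disjoint (Finset.range N) (Finset.Ico N n) := by
    rw [Finset.disjoint_left]
    intro j hj hj'
    simp only [Finset.mem_range, Finset.mem_Ico] at hj hj'
    omega
  have h := hindep.indepFun_finset _ _ hdisj hX
  exact h.comp (φ := fun x : Finset.range N → Measure ℝ =>
      est N fun j : Fin N => x ⟨j, Finset.mem_range.2 j.2⟩) (ψ := id)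
    ((hest N).comp (measurable_pi_lambda _ fun j => measurable_pi_apply _)) measurable_id

/-- Algebraic decomposition of the error of the one-step estimator. -/
lemma norm_oneStep_sub_le {E : Type*} [NormedAddCommGroup E] [NormedSpace ℝ E] {N n : ℕ}
    (hN : 1 ≤ N) (hNn : N ≤ n) {θ θ₀ ρ : E} {G V₁ V₂ : E} {K : ℝ}
    (hρ : ‖ρ‖ ≤ K * ‖θ - θ₀‖ ^ 2) :
    ‖√(n : ℝ) • (θ + (n : ℝ)⁻¹ • (G + V₂ + ((n : ℝ) - N) • (ρ + (θ₀ - θ))) - θ₀) -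
        (√(n : ℝ))⁻¹ • (V₁ + V₂)‖ ≤
      √((N : ℝ) / n) * ‖√(N : ℝ) • (θ - θ₀)‖ ^ 1 +
        K * (√(n : ℝ) / N) * ‖√(N : ℝ) • (θ - θ₀)‖ ^ 2 +
        ‖(√(n : ℝ))⁻¹ • G‖ + ‖(√(n : ℝ))⁻¹ • V₁‖ := by
  have hN0 : (0 : ℝ) < N := by exact_mod_cast hN
  have hNn' : (N : ℝ) ≤ n := by exact_mod_cast hNn
  have hn0 : (0 : ℝ) < n := hN0.trans_le hNn'
  set a := √(n : ℝ) with ha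
  have ha0 : 0 < a := Real.sqrt_pos.2 hn0
  have hsq : (n : ℝ) = a ^ 2 := (Real.sq_sqrt hn0.le).symm
  -- The cancellation behind the one-step method: the coefficient of `θ - θ₀` is `√n - (n - N)/√n =
  -- N/√n`.
  have e : a • (θ + (n : ℝ)⁻¹ • (G + V₂ + ((n : ℝ) - N) • (ρ + (θ₀ - θ))) - θ₀) -
      a⁻¹ • (V₁ + V₂) =
      (N * a⁻¹) • (θ - θ₀) + (((n : ℝ) - N) * a⁻¹) • ρ + a⁻¹ • G - a⁻¹ • V₁ := by
    rw [hsq]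
    match_scalars <;> field_simp <;> ring
  have hW : ‖√(N : ℝ) • (θ - θ₀)‖ = √(N : ℝ) * ‖θ - θ₀‖ := by
    rw [norm_smul, Real.norm_of_nonneg (by positivity)]
  have h1 : ‖(N * a⁻¹) • (θ - θ₀)‖ = √((N : ℝ) / n) * ‖√(N : ℝ) • (θ - θ₀)‖ ^ 1 := by
    rw [hW, norm_smul, Real.norm_of_nonneg (by positivity), Real.sqrt_div hN0.le, ← ha]
    nth_rewrite 1 [← Real.sq_sqrt hN0.le]
    ring
  have h2 : ‖(((n : ℝ) - N) * a⁻¹) • ρ‖ ≤ K * (a / N) * ‖√(N : ℝ) • (θ - θ₀)‖ ^ 2 := by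
    rw [hW, norm_smul, Real.norm_of_nonneg (mul_nonneg (by linarith) (by positivity)), mul_pow,
      Real.sq_sqrt hN0.le]
    calc ((n : ℝ) - N) * a⁻¹ * ‖ρ‖ ≤ n * a⁻¹ * (K * ‖θ - θ₀‖ ^ 2) := by
          gcongr
          linarith
      _ = K * (a / N) * (N * ‖θ - θ₀‖ ^ 2) := by
          rw [hsq]
          field_simp
  rw [e]
  calc ‖(N * a⁻¹) • (θ - θ₀) + (((n : ℝ) - N) * a⁻¹) • ρ + a⁻¹ • G - a⁻¹ • V₁‖
      ≤ ‖(N * a⁻¹) • (θ - θ₀)‖ + ‖(((n : ℝ) - N) * a⁻¹) • ρ‖ + ‖a⁻¹ • G‖ + ‖a⁻¹ • V₁‖ :=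
        (norm_sub_le _ _).trans (by gcongr; exact norm_add₃_le)
    _ ≤ _ := by
        rw [h1]
        gcongr

/-- Asymptotic normality of a one-step estimator with influence function `f θ` and compensator
`c θ`. -/
theorem tendstoInDistribution_oneStep [IsProbabilityMeasure P]
    (hX : ∀ j, IsPoissonProcess P T lam (X j))
    (hindep : iIndepFun X P) (hT : MeasurableSet T) (hint : IntegrableOn lam T)
    (hpos : ∀ t ∈ T, 0 ≤ lam t) {Θ : Set (EuclideanSpace ℝ (Fin d))} (hΘ : IsOpen Θ)
    {θ₀ : EuclideanSpace ℝ (Fin d)} (hθ₀ : θ₀ ∈ Θ)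
    {f : EuclideanSpace ℝ (Fin d) → ℝ → EuclideanSpace ℝ (Fin d)}
    (hf : Measurable (Function.uncurry f)) {B : ℝ} (hB : ∀ θ t, ‖f θ t‖ ≤ B)
    {c : EuclideanSpace ℝ (Fin d) → EuclideanSpace ℝ (Fin d)} {K : ℝ} (hK : 0 ≤ K)
    (hbias : ∀ θ ∈ Θ, ‖∫ t, f θ t ∂(intensityMeasure T lam) - c θ - (θ₀ - θ)‖ ≤
      K * ‖θ - θ₀‖ ^ 2)
    (hcont : Tendsto (fun θ => ∫ t, ‖f θ t - f θ₀ t‖ ^ 2 ∂(intensityMeasure T lam)) (𝓝 θ₀) (𝓝 0))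
    (hest : ∀ n, Measurable (est n)) {δ : ℝ} (hδ : δ ∈ Ioo (1 / 2 : ℝ) 1)
    (hP0 : ConditionP0 P θ₀ X est) {S : Matrix (Fin d) (Fin d) ℝ} (hS : S.PosSemidef)
    (hcov : ∀ u : EuclideanSpace ℝ (Fin d), u.ofLp ⬝ᵥ S.mulVec u.ofLp =
      ∫ t, inner ℝ u (f θ₀ t) ^ 2 ∂(intensityMeasure T lam))
    {ϑ : ℕ → Ω → EuclideanSpace ℝ (Fin d)} (hϑm : ∀ n, AEMeasurable (ϑ n) P)
    (hϑ : ∀ n, ∀ᵐ ω ∂P, (evalFirst est (learningSize δ n) fun j => X j ω) ∈ Θ →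
      ϑ n ω = (evalFirst est (learningSize δ n) fun j => X j ω) + (n : ℝ)⁻¹ •
        ∑ j ∈ Finset.Ico (learningSize δ n) n,
          (∫ t, f (evalFirst est (learningSize δ n) fun j => X j ω) t ∂(finitePart (X j ω)) -
            c (evalFirst est (learningSize δ n) fun j => X j ω))) :
    TendstoInDistribution (fun (n : ℕ) ω => √(n : ℝ) • (ϑ n ω - θ₀)) atTop id (fun _ => P)
      (multivariateGaussian 0 S) := by
  have := isFiniteMeasure_intensityMeasure hint
  set Λ := intensityMeasure T lam with hΛ
  set N : ℕ → ℕ := learningSize δ with hN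
  set U : ℕ → Ω → EuclideanSpace ℝ (Fin d) := fun n ω => evalFirst est n fun j => X j ω with hU
  have hfm (θ : EuclideanSpace ℝ (Fin d)) : Measurable (f θ) := hf.comp measurable_prodMk_left
  have hUm (n : ℕ) : Measurable (U n) := measurable_evalFirst (fun j => (hX j).measurable) hest n
  have hNlim : Tendsto N atTop atTop := tendsto_learningSize (by linarith [hδ.1])
  have hcons (ε : ℝ) (hε : 0 < ε) :
      Tendsto (fun n => P {ω | ε ≤ ‖U (N n) ω - θ₀‖}) atTop (𝓝 0) :=
    (tendstoInMeasure_iff_norm.1 hP0.consistent ε hε).comp hNlim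
  set g : EuclideanSpace ℝ (Fin d) → ℝ → EuclideanSpace ℝ (Fin d) :=
    fun θ t => f θ t - f θ₀ t with hg
  have hgm : Measurable (Function.uncurry g) := hf.sub ((hfm θ₀).comp measurable_snd)
  have hgB (θ : EuclideanSpace ℝ (Fin d)) (t : ℝ) : ‖g θ t‖ ≤ 2 * B :=
    (norm_sub_le _ _).trans (by linarith [hB θ t, hB θ₀ t])
  -- `D` is the error of replacing the estimated influence function by the true one; `V` below
  -- collects the learning terms absent from the correction.
  set D : ℕ → Ω → EuclideanSpace ℝ (Fin d) := fun n ω =>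
    ∑ j ∈ Finset.Ico (N n) n, compensatedIntegral Λ (g (U (N n) ω)) (X j ω) with hD
  set V : ℕ → Ω → EuclideanSpace ℝ (Fin d) := fun n ω =>
    ∑ j ∈ Finset.range (N n), compensatedIntegral Λ (f θ₀) (X j ω) with hV
  have hDm (n : ℕ) : Measurable fun ω => (√(n : ℝ))⁻¹ • D n ω := by
    have h1 (j : ℕ) : Measurable fun ω => compensatedIntegral Λ (g (U (N n) ω)) (X j ω) :=
      (measurable_compensatedIntegral_prod Λ hgm).comp ((hUm (N n)).prodMk (hX j).measurable)
    have h2 := Finset.measurable_fun_sum (Finset.Ico (N n) n) fun j _ => h1 j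
    exact h2.const_smul (√(n : ℝ))⁻¹
  have hVm (n : ℕ) : Measurable fun ω => (√(n : ℝ))⁻¹ • V n ω := by
    have h2 := Finset.measurable_fun_sum (Finset.range (N n)) fun j _ =>
      (measurable_compensatedIntegral Λ (hfm θ₀)).comp (hX j).measurable
    exact h2.const_smul (√(n : ℝ))⁻¹
  -- Given the learning sample, the second moment is at most twice the squared `L²` distance between
  -- the influence functions at `U` and `θ₀`. This is a bounded function of `U` vanishing in the
  -- limit at `θ₀`, so consistency suffices.
  have hDlim : Tendsto (fun n : ℕ => ∫⁻ ω, ENNReal.ofReal (‖(√(n : ℝ))⁻¹ • D n ω‖ ^ 2) ∂P) atTop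
      (𝓝 0) := by
    have h1 : Tendsto (fun θ => 2 * (1 * ∫ t, ‖g θ t‖ ^ 2 ∂Λ)) (𝓝 θ₀) (𝓝 0) := by
      simpa using (hcont.const_mul 2)
    have hb (θ : EuclideanSpace ℝ (Fin d)) : 2 * (1 * ∫ t, ‖g θ t‖ ^ 2 ∂Λ) ≤
        2 * (1 * ((2 * B) ^ 2 * Λ.real univ)) := by
      gcongr
      refine (Real.le_norm_self _).trans (norm_integral_le_of_norm_le_const (ae_of_all _ fun t => ?_))
      rw [norm_pow, norm_norm]
      gcongr
      exact hgB θ t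
    have h2 := tendsto_lintegral_of_tendstoInMeasure_const (fun n => hUm (N n)) hcons hb h1
    refine tendsto_of_tendsto_of_tendsto_of_le_of_le tendsto_const_nhds h2
      (fun _ => zero_le) fun n => ?_
    refine lintegral_norm_sq_inv_sqrt_smul_le (m := (Finset.Ico (N n) n).card) ?_
      (fun ω => integral_nonneg fun t => by positivity)
      (lintegral_norm_sq_sum_compensatedIntegral_param_le hX hindep hT hint hpos hgm hgB
        (Finset.Ico (N n) n) (hUm (N n))
        (indepFun_evalFirst (fun j => (hX j).measurable) hindep hest (N n) n))
    refine div_le_one_of_le₀ ?_ (by positivity)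
    rw [Nat.card_Ico]
    exact_mod_cast Nat.sub_le _ _
  have hVlim : Tendsto (fun n : ℕ => ∫⁻ ω, ENNReal.ofReal (‖(√(n : ℝ))⁻¹ • V n ω‖ ^ 2) ∂P) atTop
      (𝓝 0) := by
    have h1 : Tendsto (fun n : ℕ => ∫⁻ _ : Ω, ENNReal.ofReal
        (2 * ((N n : ℝ) / n * ∫ t, ‖f θ₀ t‖ ^ 2 ∂Λ)) ∂P) atTop (𝓝 0) := by
      have := ENNReal.tendsto_ofReal
        (((tendsto_learningSize_div hδ.2).mul_const (∫ t, ‖f θ₀ t‖ ^ 2 ∂Λ)).const_mul 2)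
      simpa using this
    refine tendsto_of_tendsto_of_tendsto_of_le_of_le tendsto_const_nhds h1
      (fun _ => zero_le) fun n => ?_
    refine lintegral_norm_sq_inv_sqrt_smul_le (m := N n) le_rfl
      (fun ω => integral_nonneg fun t => by positivity) ?_
    have h2 := lintegral_norm_sq_sum_compensatedIntegral_le hX hindep hT hint hpos (hfm θ₀) (hB θ₀)
      (Finset.range (N n))
    rw [Finset.card_range] at h2
    simpa using h2
  have hbd : ∀ ε : ℝ, 0 < ε → ∃ M : ℝ, ∀ n,
      P {ω | M < ‖√(N n : ℝ) • (U (N n) ω - θ₀)‖} ≤ ENNReal.ofReal ε := fun ε hε =>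
    (hP0.bounded_in_prob ε hε).imp fun M hM n => hM (N n)
  obtain ⟨r, hr, hrΘ⟩ := Metric.isOpen_iff.1 hΘ θ₀ hθ₀
  -- Slutsky: the full compensated sum at `θ₀` satisfies the central limit theorem, and the
  -- difference from it tends to `0` in probability.
  refine tendstoInDistribution_of_tendstoInMeasure_sub _ _
    (tendstoInDistribution_sum_compensatedIntegral hX hindep hT hint hpos (hfm θ₀) (hB θ₀) hS hcov)
    ?_ fun n => ((hϑm n).sub_const θ₀).const_smul (√(n : ℝ))
  rw [tendstoInMeasure_iff_norm]
  intro ε hε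
  simp only [Pi.sub_apply, Pi.zero_apply, sub_zero]
  have hε4 : 0 < ε / 4 := by positivity
  have l1 := tendsto_measure_mul_pow_of_bounded (fun n ω => norm_nonneg _) hbd
    (fun n : ℕ => Real.sqrt_nonneg ((N n : ℝ) / n))
    (by simpa using (tendsto_learningSize_div hδ.2).sqrt) 1 hε4
  have l2 := tendsto_measure_mul_pow_of_bounded (fun n ω => norm_nonneg _) hbd
    (fun n : ℕ => (by positivity : 0 ≤ K * (√(n : ℝ) / N n)))
    (by simpa using (tendsto_sqrt_div_learningSize hδ.1).const_mul K) 2 hε4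
  have l3 := tendsto_measure_of_lintegral_sq_tendsto (fun n => (hDm n).aemeasurable) hDlim hε4
  have l4 := tendsto_measure_of_lintegral_sq_tendsto (fun n => (hVm n).aemeasurable) hVlim hε4
  have hsum := ((((hcons r hr).add l1).add l2).add l3).add l4
  simp only [add_zero] at hsum
  refine tendsto_of_tendsto_of_tendsto_of_le_of_le' tendsto_const_nhds hsum
    (Eventually.of_forall fun _ => zero_le) ?_
  filter_upwards [eventually_ge_atTop 1, hNlim.eventually_ge_atTop 1] with n hn hN1
  have hNn : N n ≤ n := learningSize_le hδ.2.le hn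
  -- Five events cover the bad one: `U` leaves a ball around `θ₀` contained in `Θ`, or one of the
  -- four error terms of `norm_oneStep_sub_le` reaches `ε / 4`.
  refine le_trans (measure_mono_ae ?_) ((measure_union_le _ _).trans (add_le_add
    ((measure_union_le _ _).trans (add_le_add ((measure_union_le _ _).trans (add_le_add
      (measure_union_le _ _) le_rfl)) le_rfl)) le_rfl))
  filter_upwards [hϑ n] with ω hω hεω
  by_contra hnot
  have hεω' : ε ≤ ‖√(n : ℝ) • (ϑ n ω - θ₀) - (√(n : ℝ))⁻¹ • ∑ j ∈ Finset.range n,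
      compensatedIntegral Λ (f θ₀) (X j ω)‖ := hεω
  have hnot' : ¬ ((((r ≤ ‖U (N n) ω - θ₀‖ ∨
      ε / 4 ≤ √((N n : ℝ) / n) * ‖√(N n : ℝ) • (U (N n) ω - θ₀)‖ ^ 1) ∨
      ε / 4 ≤ K * (√(n : ℝ) / N n) * ‖√(N n : ℝ) • (U (N n) ω - θ₀)‖ ^ 2) ∨
      ε / 4 ≤ ‖(√(n : ℝ))⁻¹ • D n ω‖) ∨ ε / 4 ≤ ‖(√(n : ℝ))⁻¹ • V n ω‖) := hnot
  simp only [not_or, not_le] at hnot'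
  obtain ⟨⟨⟨⟨k0, k1⟩, k2⟩, k3⟩, k4⟩ := hnot'
  have hmem : U (N n) ω ∈ Θ := hrΘ (by rwa [Metric.mem_ball, dist_eq_norm])
  have hrange : ∑ j ∈ Finset.range n, compensatedIntegral Λ (f θ₀) (X j ω) =
      V n ω + ∑ j ∈ Finset.Ico (N n) n, compensatedIntegral Λ (f θ₀) (X j ω) :=
    (Finset.sum_range_add_sum_Ico _ hNn).symm
  -- Each summand splits into a compensated integral, taken apart as the one at `θ₀` plus a term of
  -- `D`, and a bias written as `θ₀ - U` plus a quadratic remainder.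
  have hIco : ∑ j ∈ Finset.Ico (N n) n,
      (∫ t, f (U (N n) ω) t ∂(finitePart (X j ω)) - c (U (N n) ω)) =
      D n ω + ∑ j ∈ Finset.Ico (N n) n, compensatedIntegral Λ (f θ₀) (X j ω) +
        ((n : ℝ) - N n) • ((∫ t, f (U (N n) ω) t ∂Λ - c (U (N n) ω) - (θ₀ - U (N n) ω)) +
          (θ₀ - U (N n) ω)) := by
    have h1 : ((n : ℝ) - N n) • ((∫ t, f (U (N n) ω) t ∂Λ - c (U (N n) ω) - (θ₀ - U (N n) ω)) +
        (θ₀ - U (N n) ω)) = ∑ _j ∈ Finset.Ico (N n) n, (∫ t, f (U (N n) ω) t ∂Λ -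
          c (U (N n) ω)) := by
      rw [sub_add_cancel, Finset.sum_const, Nat.card_Ico, ← Nat.cast_smul_eq_nsmul ℝ,
        Nat.cast_sub hNn]
    rw [h1, hD, ← Finset.sum_add_distrib, ← Finset.sum_add_distrib]
    refine Finset.sum_congr rfl fun j _ => ?_
    rw [hg, compensatedIntegral_sub Λ (hfm _) (hfm _) (hB _) (hB _)]
    simp only [compensatedIntegral]
    abel
  have hle := norm_oneStep_sub_le hN1 hNn (G := D n ω) (V₁ := V n ω)
    (V₂ := ∑ j ∈ Finset.Ico (N n) n, compensatedIntegral Λ (f θ₀) (X j ω))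
    (hbias (U (N n) ω) hmem)
  rw [← hIco, ← hrange, ← hω hmem] at hle
  linarith

end OneStep

/-! ### Pointwise estimates for regular intensities -/

/-- The gradient `λ̇(ϑ, t) / λ(ϑ, t)` of the log-intensity. -/
noncomputable def logGrad {d : ℕ} (lam : EuclideanSpace ℝ (Fin d) → ℝ → ℝ)
    (θ : EuclideanSpace ℝ (Fin d)) (t : ℝ) : EuclideanSpace ℝ (Fin d) :=
  (lam θ t)⁻¹ • intensityGrad lam θ t

/-- A family of intensities on `T`, indexed by a convex open set `Θ` of diameter at most `D`, whose
log-derivatives up to the third order are bounded by `C` and whose Fisher information is bounded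
below by `c`. -/
structure RegularIntensity {d : ℕ} (T : Set ℝ) (Θ : Set (EuclideanSpace ℝ (Fin d)))
    (lam : EuclideanSpace ℝ (Fin d) → ℝ → ℝ) (C D c : ℝ) : Prop where
  measurableSet : MeasurableSet T
  isOpen : IsOpen Θ
  convex : Convex ℝ Θ
  dist_le : ∀ θ ∈ Θ, ∀ η ∈ Θ, ‖θ - η‖ ≤ D
  measurable : ∀ θ ∈ Θ, Measurable (lam θ)
  integrableOn : ∀ θ ∈ Θ, IntegrableOn (lam θ) T
  pos : ∀ θ ∈ Θ, ∀ t ∈ T, 0 < lam θ t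
  contDiffOn : ∀ t ∈ T, ContDiffOn ℝ 3 (fun θ => Real.log (lam θ t)) Θ
  nonneg : 0 ≤ C
  bounded : ∀ k ∈ Finset.Icc 1 3, ∀ θ ∈ Θ, ∀ t ∈ T,
    ‖iteratedFDeriv ℝ k (fun η => Real.log (lam η t)) θ‖ ≤ C
  c_pos : 0 < c
  nondegenerate : ∀ θ ∈ Θ, ∀ μ : EuclideanSpace ℝ (Fin d), ‖μ‖ = 1 →
    c ≤ inner ℝ μ (Matrix.toEuclideanLin (fisherInfo T lam θ) μ)

namespace RegularIntensity

variable {d : ℕ} {T : Set ℝ} {Θ : Set (EuclideanSpace ℝ (Fin d))}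
  {lam : EuclideanSpace ℝ (Fin d) → ℝ → ℝ} {C D c : ℝ} {θ η : EuclideanSpace ℝ (Fin d)} {t : ℝ}

lemma differentiableAt_log (h : RegularIntensity T Θ lam C D c) (hθ : θ ∈ Θ) (ht : t ∈ T) :
    DifferentiableAt ℝ (fun η => Real.log (lam η t)) θ :=
  ((h.contDiffOn t ht).contDiffAt (h.isOpen.mem_nhds hθ)).differentiableAt (by norm_num)

/-- Smoothness is assumed for `ln λ` only; it passes to `λ = exp (ln λ)` near `θ`, where `λ` is
positive. -/
lemma hasFDerivAt (h : RegularIntensity T Θ lam C D c) (hθ : θ ∈ Θ) (ht : t ∈ T) :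
    HasFDerivAt (fun η => lam η t)
      (lam θ t • fderiv ℝ (fun η => Real.log (lam η t)) θ) θ := by
  have h1 := (h.differentiableAt_log hθ ht).hasFDerivAt.exp
  rw [Real.exp_log (h.pos θ hθ t ht)] at h1
  refine h1.congr_of_eventuallyEq ?_
  filter_upwards [h.isOpen.mem_nhds hθ] with η hη
  rw [Real.exp_log (h.pos η hη t ht)]

lemma toDual_logGrad (h : RegularIntensity T Θ lam C D c) (hθ : θ ∈ Θ) (ht : t ∈ T) :
    InnerProductSpace.toDual ℝ _ (logGrad lam θ t) =
      fderiv ℝ (fun η => Real.log (lam η t)) θ := by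
  rw [logGrad, intensityGrad, gradient, (h.hasFDerivAt hθ ht).fderiv, map_smulₛₗ]
  simp [smul_smul, inv_mul_cancel₀ (h.pos θ hθ t ht).ne']

lemma intensityGrad_eq (h : RegularIntensity T Θ lam C D c) (hθ : θ ∈ Θ) (ht : t ∈ T) :
    intensityGrad lam θ t = lam θ t • logGrad lam θ t := by
  rw [logGrad, smul_smul, mul_inv_cancel₀ (h.pos θ hθ t ht).ne', one_smul]

lemma norm_logGrad_le (h : RegularIntensity T Θ lam C D c) (hθ : θ ∈ Θ) (ht : t ∈ T) :
    ‖logGrad lam θ t‖ ≤ C := by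
  rw [← (InnerProductSpace.toDual ℝ _).norm_map, h.toDual_logGrad hθ ht,
    ← norm_iteratedFDeriv_one]
  exact h.bounded 1 (by simp) θ hθ t ht

lemma norm_fderiv_sub_le (h : RegularIntensity T Θ lam C D c) (hθ : θ ∈ Θ) (hη : η ∈ Θ)
    (ht : t ∈ T) : ‖fderiv ℝ (fun η => Real.log (lam η t)) θ -
      fderiv ℝ (fun η => Real.log (lam η t)) η‖ ≤ C * ‖θ - η‖ := by
  have hc : ContDiffOn ℝ 2 (fderiv ℝ (fun η => Real.log (lam η t))) Θ :=
    (h.contDiffOn t ht).fderiv_of_isOpen h.isOpen (by norm_num)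
  refine Convex.norm_image_sub_le_of_norm_fderiv_le (𝕜 := ℝ)
    (fun x hx => (hc.contDiffAt (h.isOpen.mem_nhds hx)).differentiableAt (by norm_num))
    (fun x hx => ?_) h.convex hη hθ
  rw [← norm_iteratedFDeriv_one, norm_iteratedFDeriv_fderiv]
  exact h.bounded 2 (by simp) x hx t ht

lemma norm_logGrad_sub_le (h : RegularIntensity T Θ lam C D c) (hθ : θ ∈ Θ) (hη : η ∈ Θ)
    (ht : t ∈ T) : ‖logGrad lam θ t - logGrad lam η t‖ ≤ C * ‖θ - η‖ := by
  rw [← (InnerProductSpace.toDual ℝ _).norm_map, map_sub, h.toDual_logGrad hθ ht,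
    h.toDual_logGrad hη ht]
  exact h.norm_fderiv_sub_le hθ hη ht

lemma continuousOn_logGrad (h : RegularIntensity T Θ lam C D c) (ht : t ∈ T) :
    ContinuousOn (fun θ => logGrad lam θ t) Θ :=
  (LipschitzOnWith.of_dist_le_mul (K := ⟨C, h.nonneg⟩) fun θ hθ η hη => by
    rw [dist_eq_norm, dist_eq_norm]
    exact h.norm_logGrad_sub_le hθ hη ht).continuousOn

lemma continuousOn_intensity (h : RegularIntensity T Θ lam C D c) (ht : t ∈ T) :
    ContinuousOn (fun θ => lam θ t) Θ := fun _ hθ =>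
  (h.hasFDerivAt hθ ht).continuousAt.continuousWithinAt

lemma abs_log_sub_le (h : RegularIntensity T Θ lam C D c) (hθ : θ ∈ Θ) (hη : η ∈ Θ)
    (ht : t ∈ T) : |Real.log (lam θ t) - Real.log (lam η t)| ≤ C * ‖θ - η‖ := by
  refine Convex.norm_image_sub_le_of_norm_fderiv_le (𝕜 := ℝ)
    (f := fun η => Real.log (lam η t)) (fun x hx => h.differentiableAt_log hx ht)
    (fun x hx => ?_) h.convex hη hθ
  rw [← norm_iteratedFDeriv_one]
  exact h.bounded 1 (by simp) x hx t ht

/-- Along the segment the derivative differs from its value at `θ` by at most `C ‖η - θ‖`, so the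
mean value inequality bounds the Taylor remainder. -/
lemma abs_log_sub_sub_le (h : RegularIntensity T Θ lam C D c) (hθ : θ ∈ Θ) (hη : η ∈ Θ)
    (ht : t ∈ T) : |Real.log (lam η t) - Real.log (lam θ t) -
      inner ℝ (logGrad lam θ t) (η - θ)| ≤ C * ‖η - θ‖ ^ 2 := by
  have hseg : segment ℝ θ η ⊆ Θ := h.convex.segment_subset hθ hη
  have h1 := Convex.norm_image_sub_le_of_norm_fderiv_le' (𝕜 := ℝ)
    (f := fun η => Real.log (lam η t)) (C := C * ‖η - θ‖) (s := segment ℝ θ η)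
    (φ := fderiv ℝ (fun η => Real.log (lam η t)) θ)
    (fun x hx => h.differentiableAt_log (hseg hx) ht) (fun x hx => ?_) (convex_segment θ η)
    (left_mem_segment ℝ θ η) (right_mem_segment ℝ θ η)
  · rw [← h.toDual_logGrad hθ ht, InnerProductSpace.toDual_apply_apply] at h1
    rw [sq, ← mul_assoc]
    exact h1
  · refine (h.norm_fderiv_sub_le (hseg hx) hθ ht).trans ?_
    have := h.nonneg
    gcongr
    obtain ⟨s, ⟨hs0, hs1⟩, rfl⟩ := segment_eq_image' ℝ θ η ▸ hx
    rw [add_sub_cancel_left, norm_smul, Real.norm_of_nonneg hs0]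
    exact mul_le_of_le_one_left (norm_nonneg _) hs1

lemma abs_log_sub_le' (h : RegularIntensity T Θ lam C D c) (hθ : θ ∈ Θ) (hη : η ∈ Θ)
    (ht : t ∈ T) : |Real.log (lam θ t) - Real.log (lam η t)| ≤ C * D :=
  (h.abs_log_sub_le hθ hη ht).trans (mul_le_mul_of_nonneg_left (h.dist_le θ hθ η hη) h.nonneg)

lemma intensity_eq (h : RegularIntensity T Θ lam C D c) (hθ : θ ∈ Θ) (hη : η ∈ Θ) (ht : t ∈ T) :
    lam θ t = lam η t * Real.exp (Real.log (lam θ t) - Real.log (lam η t)) := by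
  rw [Real.exp_sub, Real.exp_log (h.pos θ hθ t ht), Real.exp_log (h.pos η hη t ht),
    mul_div_cancel₀ _ (h.pos η hη t ht).ne']

/-- Boundedness of `Θ` makes all intensities of the family comparable, uniformly in `t`; any one of
them then dominates the others up to a constant. -/
lemma intensity_le (h : RegularIntensity T Θ lam C D c) (hθ : θ ∈ Θ) (hη : η ∈ Θ) (ht : t ∈ T) :
    lam θ t ≤ Real.exp (C * D) * lam η t := by
  rw [h.intensity_eq hθ hη ht, mul_comm]
  have := (h.pos η hη t ht).le
  gcongr
  exact (le_abs_self _).trans (h.abs_log_sub_le' hθ hη ht)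

/-- The second-order expansion of the intensity. -/
lemma abs_intensity_sub_sub_le (h : RegularIntensity T Θ lam C D c) (hθ : θ ∈ Θ) (hη : η ∈ Θ)
    (ht : t ∈ T) : |lam η t - lam θ t - lam θ t * inner ℝ (logGrad lam θ t) (η - θ)| ≤
      Real.exp (C * D) * (C ^ 2 * Real.exp (C * D) + C) * ‖θ - η‖ ^ 2 * lam η t := by
  set a := Real.log (lam η t) - Real.log (lam θ t) with ha
  set b : ℝ := inner ℝ (logGrad lam θ t) (η - θ) with hb
  have hC := h.nonneg
  have hlθ := h.pos θ hθ t ht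
  have hlη := h.pos η hη t ht
  -- With `λ(η) = λ(θ) eᵃ`, the error splits into the Taylor remainder of `exp` at `a` and that of
  -- the log-intensity, both quadratic. Below, `λ(θ)` is traded for `λ(η)`, since `η` will be the
  -- true parameter.
  have e : lam η t - lam θ t - lam θ t * b =
      lam θ t * ((Real.exp a - 1 - a) + (a - b)) := by
    rw [h.intensity_eq hη hθ ht]
    ring
  have h1 : |Real.exp a - 1 - a| ≤ |a| ^ 2 * Real.exp |a| := by
    have h3 := Complex.norm_exp_sub_sum_le_norm_mul_exp (a : ℂ) 2
    simp only [Finset.sum_range_succ, Finset.sum_range_zero, pow_zero, Nat.factorial,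
      Complex.norm_real, Real.norm_eq_abs] at h3
    refine le_trans (le_of_eq ?_) h3
    rw [← Real.norm_eq_abs, ← Complex.norm_real]
    push_cast
    congr 1
    ring
  have h2 : |a| ≤ C * ‖θ - η‖ := by
    rw [norm_sub_rev]
    exact h.abs_log_sub_le hη hθ ht
  have h4 : |a| ≤ C * D := h.abs_log_sub_le' hη hθ ht
  have h5 : |a - b| ≤ C * ‖θ - η‖ ^ 2 := by
    rw [norm_sub_rev]
    exact h.abs_log_sub_sub_le hθ hη ht
  rw [e, abs_mul, abs_of_pos hlθ]
  calc lam θ t * |Real.exp a - 1 - a + (a - b)|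
      ≤ (Real.exp (C * D) * lam η t) *
          ((C * ‖θ - η‖) ^ 2 * Real.exp (C * D) + C * ‖θ - η‖ ^ 2) := by
        gcongr
        · exact h.intensity_le hθ hη ht
        · refine (abs_add_le _ _).trans (add_le_add (h1.trans ?_) h5)
          gcongr
    _ = _ := by ring

/-- Each partial derivative is a pointwise limit of difference quotients, which are measurable in
`t`. -/
lemma measurable_indicator_intensityGrad (h : RegularIntensity T Θ lam C D c) (hθ : θ ∈ Θ) :
    Measurable (T.indicator (intensityGrad lam θ)) := by
  have key (i : Fin d) : Measurable (T.indicator fun t => intensityGrad lam θ t i) := by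
    set e : EuclideanSpace ℝ (Fin d) := EuclideanSpace.single i 1 with he
    have hpt : Tendsto (fun k : ℕ => θ + (1 / ((k : ℝ) + 1)) • e) atTop (𝓝 θ) := by
      simpa using (tendsto_one_div_add_atTop_nhds_zero_nat (𝕜 := ℝ)).smul_const e |>.const_add θ
    -- Measurability of the intensity is known only at parameters in `Θ`, so the steps start late
    -- enough to stay inside.
    obtain ⟨k₀, hk₀⟩ := eventually_atTop.1 (hpt.eventually (h.isOpen.mem_nhds hθ))
    refine measurable_of_tendsto_metrizable (f := fun k => T.indicator fun t =>
      (1 / (((k + k₀ : ℕ) : ℝ) + 1))⁻¹ •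
        (lam (θ + (1 / (((k + k₀ : ℕ) : ℝ) + 1)) • e) t - lam θ t)) (fun k => ?_) ?_
    · refine Measurable.indicator ?_ h.measurableSet
      exact ((h.measurable _ (hk₀ (k + k₀) (Nat.le_add_left _ _))).sub
        (h.measurable θ hθ)).const_smul (1 / (((k + k₀ : ℕ) : ℝ) + 1))⁻¹
    · rw [tendsto_pi_nhds]
      intro t
      by_cases ht : t ∈ T
      · simp only [indicator_of_mem ht]
        have hlim : Tendsto (fun k : ℕ => 1 / (((k + k₀ : ℕ) : ℝ) + 1)) atTop (𝓝[≠] 0) :=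
          tendsto_nhdsWithin_iff.2
            ⟨(tendsto_one_div_add_atTop_nhds_zero_nat (𝕜 := ℝ)).comp (tendsto_add_atTop_nat k₀),
              Eventually.of_forall fun k => (Nat.one_div_pos_of_nat (α := ℝ)).ne'⟩
        have h1 := (((h.hasFDerivAt hθ ht).hasLineDerivAt e).tendsto_slope_zero).comp hlim
        have h2 : (lam θ t • fderiv ℝ (fun η => Real.log (lam η t)) θ) e =
            intensityGrad lam θ t i := by
          rw [← h.toDual_logGrad hθ ht, h.intensityGrad_eq hθ ht]
          simp [he, EuclideanSpace.inner_single_right]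
        rw [h2] at h1
        exact h1
      · simp [indicator_of_notMem ht]
  have hm : Measurable fun t => WithLp.toLp 2 fun i => T.indicator (fun t =>
      intensityGrad lam θ t i) t := by
    have : Measurable fun t i => T.indicator (fun t => intensityGrad lam θ t i) t :=
      measurable_pi_lambda _ fun i => key i
    fun_prop
  convert hm using 1
  ext t i
  by_cases ht : t ∈ T <;> simp [ht]

lemma measurable_indicator_logGrad (h : RegularIntensity T Θ lam C D c) (hθ : θ ∈ Θ) :
    Measurable (T.indicator (logGrad lam θ)) := by
  have := (h.measurable θ hθ).inv.smul (h.measurable_indicator_intensityGrad hθ)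
  convert this using 1
  ext t i
  by_cases ht : t ∈ T <;> simp [ht, logGrad]

end RegularIntensity

/-! ### Joint measurability and the Fisher information -/

/-- Joint measurability of functions which are continuous in one variable and measurable in the
other one, on a rectangle. -/
lemma measurable_uncurry_indicator_of_continuousOn {E F : Type*} [TopologicalSpace E]
    [TopologicalSpace.MetrizableSpace E] [SecondCountableTopology E] [MeasurableSpace E]
    [OpensMeasurableSpace E] [TopologicalSpace F] [TopologicalSpace.PseudoMetrizableSpace F]
    [MeasurableSpace F] [BorelSpace F] [Zero F] {Θ : Set E} (hΘ : MeasurableSet Θ) {T : Set ℝ}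
    {g : E → ℝ → F} (hc : ∀ t ∈ T, ContinuousOn (fun θ => g θ t) Θ)
    (hm : ∀ θ ∈ Θ, Measurable (T.indicator (g θ))) :
    Measurable (Function.uncurry (Θ.indicator fun θ => T.indicator (g θ))) := by
  -- On the subtype `Θ` this is a Carathéodory function, continuous in `θ` and measurable in `t`; it
  -- is then extended by `0` along a measurable embedding.
  have h1 : Measurable (Function.uncurry fun (θ : Θ) t => T.indicator (g θ) t) := by
    refine measurable_uncurry_of_continuous_of_measurable (fun t => ?_) fun θ => hm θ θ.2
    by_cases ht : t ∈ T
    · simp only [indicator_of_mem ht]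
      exact continuousOn_iff_continuous_domRestrict.1 (hc t ht)
    · simp only [indicator_of_notMem ht]
      exact continuous_const
  have hemb : MeasurableEmbedding (Prod.map ((↑) : Θ → E) (id : ℝ → ℝ)) :=
    (MeasurableEmbedding.subtype_coe hΘ).prodMap MeasurableEmbedding.id
  convert hemb.measurable_extend h1 (measurable_const (a := (0 : F))) using 1
  ext ⟨θ, t⟩
  by_cases hθ : θ ∈ Θ
  · have := hemb.injective.extend_apply (Function.uncurry fun (θ : Θ) t => T.indicator (g θ) t)
      (fun _ => 0) (⟨θ, hθ⟩, t)
    simp only [Prod.map_apply, id_eq] at this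
    rw [this]
    simp [hθ]
  · rw [Function.extend_apply']
    · simp [hθ]
    · rintro ⟨⟨⟨θ', hθ'⟩, t'⟩, heq⟩
      simp only [Prod.map_apply, Prod.mk.injEq] at heq
      exact hθ (heq.1 ▸ hθ')

lemma aestronglyMeasurable_of_measurable_indicator {F : Type*} [TopologicalSpace F]
    [TopologicalSpace.PseudoMetrizableSpace F] [SecondCountableTopology F] [MeasurableSpace F]
    [BorelSpace F] [Zero F] {T : Set ℝ} (hT : MeasurableSet T) {φ : ℝ → F}
    (hφ : Measurable (T.indicator φ)) (μ : Measure ℝ) :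
    AEStronglyMeasurable φ (μ.restrict T) :=
  hφ.aestronglyMeasurable.congr (indicator_ae_eq_restrict hT)

/-- The inverse of the Fisher information as a continuous linear map. -/
noncomputable def invFisher {d : ℕ} (T : Set ℝ) (lam : EuclideanSpace ℝ (Fin d) → ℝ → ℝ)
    (θ : EuclideanSpace ℝ (Fin d)) : EuclideanSpace ℝ (Fin d) →L[ℝ] EuclideanSpace ℝ (Fin d) :=
  LinearMap.toContinuousLinearMap (Matrix.toEuclideanLin (fisherInfo T lam θ)⁻¹)

namespace RegularIntensity

variable {d : ℕ} {T : Set ℝ} {Θ : Set (EuclideanSpace ℝ (Fin d))}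
  {lam : EuclideanSpace ℝ (Fin d) → ℝ → ℝ} {C D c : ℝ} {θ η : EuclideanSpace ℝ (Fin d)} {t : ℝ}

lemma integrableOn_smul {F : Type*} [NormedAddCommGroup F] [NormedSpace ℝ F]
    [SecondCountableTopology F] [MeasurableSpace F] [BorelSpace F]
    (h : RegularIntensity T Θ lam C D c) (hθ : θ ∈ Θ) {φ : ℝ → F}
    (hφ : Measurable (T.indicator φ)) {B : ℝ} (hB : ∀ t ∈ T, ‖φ t‖ ≤ B) :
    IntegrableOn (fun t => lam θ t • φ t) T := by
  refine Integrable.mono' ((h.integrableOn θ hθ).mul_const B)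
    ((h.measurable θ hθ).aestronglyMeasurable.smul
      (aestronglyMeasurable_of_measurable_indicator h.measurableSet hφ _)) ?_
  filter_upwards [ae_restrict_mem h.measurableSet] with t ht
  have := h.pos θ hθ t ht
  rw [norm_smul, Real.norm_of_nonneg this.le]
  gcongr
  exact hB t ht

lemma measurable_indicator_comp {F : Type*} [TopologicalSpace F] [MeasurableSpace F] [BorelSpace F]
    [Zero F] (h : RegularIntensity T Θ lam C D c) (hθ : θ ∈ Θ)
    {ψ : EuclideanSpace ℝ (Fin d) → F} (hψ : Continuous ψ) :
    Measurable (T.indicator fun t => ψ (logGrad lam θ t)) := by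
  have h1 := (hψ.measurable.comp (h.measurable_indicator_logGrad hθ)).indicator h.measurableSet
  convert h1 using 1
  ext t
  by_cases ht : t ∈ T <;> simp [ht]

lemma norm_inner_logGrad_le (h : RegularIntensity T Θ lam C D c) (hθ : θ ∈ Θ) (ht : t ∈ T)
    (v : EuclideanSpace ℝ (Fin d)) : ‖inner ℝ (logGrad lam θ t) v‖ ≤ C * ‖v‖ :=
  (norm_inner_le_norm _ _).trans (by gcongr; exact h.norm_logGrad_le hθ ht)

lemma norm_inner_smul_logGrad_le (h : RegularIntensity T Θ lam C D c) (hθ : θ ∈ Θ) (ht : t ∈ T)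
    (v : EuclideanSpace ℝ (Fin d)) :
    ‖(inner ℝ (logGrad lam θ t) v : ℝ) • logGrad lam θ t‖ ≤ C * ‖v‖ * C := by
  have := h.nonneg
  rw [norm_smul]
  gcongr
  · exact h.norm_inner_logGrad_le hθ ht v
  · exact h.norm_logGrad_le hθ ht

lemma integrableOn_logGrad (h : RegularIntensity T Θ lam C D c) (hθ : θ ∈ Θ) (hη : η ∈ Θ) :
    IntegrableOn (fun t => lam θ t • logGrad lam η t) T :=
  h.integrableOn_smul hθ (h.measurable_indicator_logGrad hη) fun _ ht => h.norm_logGrad_le hη ht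

lemma integrableOn_inner_smul_logGrad (h : RegularIntensity T Θ lam C D c) (hθ : θ ∈ Θ)
    (v : EuclideanSpace ℝ (Fin d)) :
    IntegrableOn (fun t => lam θ t • (inner ℝ (logGrad lam θ t) v : ℝ) • logGrad lam θ t) T :=
  h.integrableOn_smul hθ
    (h.measurable_indicator_comp hθ (ψ := fun s => (inner ℝ s v : ℝ) • s) (by fun_prop))
    fun _ ht => h.norm_inner_smul_logGrad_le hθ ht v

lemma fisherInfo_apply (h : RegularIntensity T Θ lam C D c) (hθ : θ ∈ Θ) (i j : Fin d) :
    fisherInfo T lam θ i j =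
      ∫ t in T, lam θ t * (logGrad lam θ t i * logGrad lam θ t j) := by
  rw [fisherInfo, Matrix.of_apply]
  refine setIntegral_congr_fun h.measurableSet fun t ht => ?_
  have := (h.pos θ hθ t ht).ne'
  simp only [h.intensityGrad_eq hθ ht, PiLp.smul_apply, smul_eq_mul]
  field_simp

lemma abs_logGrad_mul_le (h : RegularIntensity T Θ lam C D c) (hθ : θ ∈ Θ) (ht : t ∈ T)
    (i j : Fin d) : ‖logGrad lam θ t i * logGrad lam θ t j‖ ≤ C * C := by
  have h1 (i : Fin d) := (PiLp.norm_apply_le (logGrad lam θ t) i).trans (h.norm_logGrad_le hθ ht)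
  have := h.nonneg
  rw [norm_mul]
  gcongr
  exacts [h1 i, h1 j]

lemma measurable_indicator_logGrad_mul (h : RegularIntensity T Θ lam C D c) (hθ : θ ∈ Θ)
    (i j : Fin d) : Measurable (T.indicator fun t => logGrad lam θ t i * logGrad lam θ t j) :=
  h.measurable_indicator_comp hθ (ψ := fun s => s i * s j) (by fun_prop)

/-- In this form the information applied to `v` is the linear term of the intensity expansion in
direction `v`, integrated against the log-gradient; this drives the bias cancellation. -/
lemma toEuclideanLin_fisherInfo (h : RegularIntensity T Θ lam C D c) (hθ : θ ∈ Θ)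
    (v : EuclideanSpace ℝ (Fin d)) : Matrix.toEuclideanLin (fisherInfo T lam θ) v =
      ∫ t in T, lam θ t • (inner ℝ (logGrad lam θ t) v : ℝ) • logGrad lam θ t := by
  ext i
  have hproj := (EuclideanSpace.proj (𝕜 := ℝ) i).integral_comp_comm
    (h.integrableOn_inner_smul_logGrad hθ v)
  refine Eq.trans ?_ hproj
  have hi (j : Fin d) : Integrable (fun t => lam θ t * (logGrad lam θ t i * logGrad lam θ t j) *
      v j) (volume.restrict T) :=
    (h.integrableOn_smul hθ (h.measurable_indicator_logGrad_mul hθ i j)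
      fun t ht => h.abs_logGrad_mul_le hθ ht i j).mul_const (v j)
  simp only [Matrix.toLpLin_apply, Matrix.mulVec, dotProduct, h.fisherInfo_apply hθ]
  simp only [← integral_mul_const]
  rw [← integral_finsetSum _ fun j _ => hi j]
  refine integral_congr_ae (ae_of_all _ fun t => ?_)
  simp only [map_smul, smul_eq_mul, PiLp.inner_apply, RCLike.inner_apply, conj_trivial]
  change _ = lam θ t * ((∑ j, v j * logGrad lam θ t j) * logGrad lam θ t i)
  rw [Finset.sum_mul, Finset.mul_sum]
  exact Finset.sum_congr rfl fun j _ => by ring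

lemma inner_fisherInfo (h : RegularIntensity T Θ lam C D c) (hθ : θ ∈ Θ)
    (u v : EuclideanSpace ℝ (Fin d)) : inner ℝ u (Matrix.toEuclideanLin (fisherInfo T lam θ) v) =
      ∫ t in T, lam θ t * (inner ℝ (logGrad lam θ t) u * inner ℝ (logGrad lam θ t) v) := by
  rw [h.toEuclideanLin_fisherInfo hθ, ← integral_inner (h.integrableOn_inner_smul_logGrad hθ v)]
  refine integral_congr_ae (ae_of_all _ fun t => ?_)
  simp only [inner_smul_right, real_inner_comm (logGrad lam θ t) u]
  rw [real_inner_comm]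
  ring

lemma inner_fisherInfo_comm (h : RegularIntensity T Θ lam C D c) (hθ : θ ∈ Θ)
    (u v : EuclideanSpace ℝ (Fin d)) : inner ℝ u (Matrix.toEuclideanLin (fisherInfo T lam θ) v) =
      inner ℝ (Matrix.toEuclideanLin (fisherInfo T lam θ) u) v := by
  rw [h.inner_fisherInfo hθ, real_inner_comm v, h.inner_fisherInfo hθ]
  simp only [mul_comm]

lemma le_inner_fisherInfo (h : RegularIntensity T Θ lam C D c) (hθ : θ ∈ Θ)
    (v : EuclideanSpace ℝ (Fin d)) :
    c * ‖v‖ ^ 2 ≤ inner ℝ v (Matrix.toEuclideanLin (fisherInfo T lam θ) v) := by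
  rcases eq_or_ne v 0 with rfl | hv
  · simp
  have hv0 : ‖v‖ ≠ 0 := norm_ne_zero_iff.2 hv
  have h1 := h.nondegenerate θ hθ (‖v‖⁻¹ • v) (by
    rw [norm_smul, norm_inv, norm_norm, inv_mul_cancel₀ hv0])
  rw [map_smul, inner_smul_left, inner_smul_right, conj_trivial] at h1
  calc c * ‖v‖ ^ 2 ≤ (‖v‖⁻¹ * (‖v‖⁻¹ *
        inner ℝ v (Matrix.toEuclideanLin (fisherInfo T lam θ) v))) * ‖v‖ ^ 2 := by gcongr
    _ = _ := by field_simp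

lemma posDef_fisherInfo (h : RegularIntensity T Θ lam C D c) (hθ : θ ∈ Θ) :
    (fisherInfo T lam θ).PosDef := by
  refine Matrix.PosDef.of_dotProduct_mulVec_pos ?_ fun x hx => ?_
  · ext i j
    simp only [Matrix.conjTranspose_apply, star_trivial, h.fisherInfo_apply hθ, mul_comm]
  · have h1 := h.le_inner_fisherInfo hθ (WithLp.toLp 2 x)
    have h2 : 0 < ‖WithLp.toLp 2 x‖ := norm_pos_iff.2 fun h0 => hx (by simpa using h0)
    have h3 := h.c_pos
    rw [EuclideanSpace.inner_eq_star_dotProduct, Matrix.toLpLin_apply, dotProduct_comm] at h1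
    exact lt_of_lt_of_le (by positivity) h1

lemma isUnit_det_fisherInfo (h : RegularIntensity T Θ lam C D c) (hθ : θ ∈ Θ) :
    IsUnit (fisherInfo T lam θ).det :=
  (h.posDef_fisherInfo hθ).det_pos.ne'.isUnit

lemma fisherInfo_invFisher (h : RegularIntensity T Θ lam C D c) (hθ : θ ∈ Θ)
    (v : EuclideanSpace ℝ (Fin d)) :
    Matrix.toEuclideanLin (fisherInfo T lam θ) (invFisher T lam θ v) = v := by
  simp [invFisher, Matrix.toLpLin_apply, Matrix.mulVec_mulVec,
    Matrix.mul_nonsing_inv _ (h.isUnit_det_fisherInfo hθ)]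

lemma invFisher_fisherInfo (h : RegularIntensity T Θ lam C D c) (hθ : θ ∈ Θ)
    (v : EuclideanSpace ℝ (Fin d)) :
    invFisher T lam θ (Matrix.toEuclideanLin (fisherInfo T lam θ) v) = v := by
  simp [invFisher, Matrix.toLpLin_apply, Matrix.mulVec_mulVec,
    Matrix.nonsing_inv_mul _ (h.isUnit_det_fisherInfo hθ)]

/-- Coercivity at `w = I(θ)⁻¹ v`: `c ‖w‖² ≤ ⟨w, I(θ) w⟩ ≤ ‖w‖ ‖v‖`. -/
lemma norm_invFisher_le (h : RegularIntensity T Θ lam C D c) (hθ : θ ∈ Θ)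
    (v : EuclideanSpace ℝ (Fin d)) : ‖invFisher T lam θ v‖ ≤ c⁻¹ * ‖v‖ := by
  have h1 := h.le_inner_fisherInfo hθ (invFisher T lam θ v)
  rw [h.fisherInfo_invFisher hθ] at h1
  have h2 := h1.trans (real_inner_le_norm _ _)
  have hc := h.c_pos
  rcases (norm_nonneg (invFisher T lam θ v)).eq_or_lt with h0 | h0
  · rw [← h0]
    positivity
  · rw [inv_mul_eq_div, le_div_iff₀ hc]
    nlinarith

lemma inner_invFisher_comm (h : RegularIntensity T Θ lam C D c) (hθ : θ ∈ Θ)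
    (u v : EuclideanSpace ℝ (Fin d)) :
    inner ℝ u (invFisher T lam θ v) = inner ℝ (invFisher T lam θ u) v := by
  conv_lhs => rw [← h.fisherInfo_invFisher hθ u]
  rw [← h.inner_fisherInfo_comm hθ, h.fisherInfo_invFisher hθ]

/-- Dominated convergence: comparability of intensities gives the bound `e^{CD} λ(θ₀, t) C²` for an
arbitrary fixed `θ₀` in `Θ`. -/
lemma continuousOn_fisherInfo (h : RegularIntensity T Θ lam C D c) :
    ContinuousOn (fisherInfo T lam) Θ := by
  rcases Θ.eq_empty_or_nonempty with rfl | ⟨θ₀, hθ₀⟩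
  · exact continuousOn_empty _
  refine continuousOn_pi.2 fun i => continuousOn_pi.2 fun j => ?_
  have h1 : ContinuousOn (fun θ => ∫ t in T, lam θ t * (logGrad lam θ t i * logGrad lam θ t j))
      Θ := by
    refine continuousOn_of_dominated (bound := fun t => Real.exp (C * D) * lam θ₀ t * (C * C))
      (fun θ hθ => ?_) (fun θ hθ => ?_) (((h.integrableOn θ₀ hθ₀).const_mul _).mul_const _) ?_
    · exact (h.integrableOn_smul hθ (h.measurable_indicator_logGrad_mul hθ i j)
        fun t ht => h.abs_logGrad_mul_le hθ ht i j).aestronglyMeasurable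
    · filter_upwards [ae_restrict_mem h.measurableSet] with t ht
      rw [norm_mul, Real.norm_of_nonneg (h.pos θ hθ t ht).le]
      have := h.pos θ₀ hθ₀ t ht
      gcongr
      · exact h.intensity_le hθ hθ₀ ht
      · exact h.abs_logGrad_mul_le hθ ht i j
    · filter_upwards [ae_restrict_mem h.measurableSet] with t ht
      have h2 := h.continuousOn_logGrad ht
      have h3 (i : Fin d) : ContinuousOn (fun θ => logGrad lam θ t i) Θ :=
        (EuclideanSpace.proj (𝕜 := ℝ) i).continuous.comp_continuousOn h2
      exact (h.continuousOn_intensity ht).mul ((h3 i).mul (h3 j))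
  exact h1.congr fun θ hθ => h.fisherInfo_apply hθ i j

/-- Cramer's formula: adjugate and determinant are continuous, and the determinant does not vanish
on `Θ`. -/
lemma continuousOn_inv_fisherInfo (h : RegularIntensity T Θ lam C D c) :
    ContinuousOn (fun θ => (fisherInfo T lam θ)⁻¹) Θ := by
  simp only [Matrix.inv_def, Ring.inverse_eq_inv']
  have hdet : Continuous fun A : Matrix (Fin d) (Fin d) ℝ => A.det :=
    continuous_id.matrix_det
  have hadj : Continuous fun A : Matrix (Fin d) (Fin d) ℝ => A.adjugate :=
    continuous_id.matrix_adjugate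
  exact ((hdet.comp_continuousOn h.continuousOn_fisherInfo).inv₀ fun θ hθ =>
    (h.isUnit_det_fisherInfo hθ).ne_zero).smul (hadj.comp_continuousOn h.continuousOn_fisherInfo)

lemma continuousOn_invFisher_apply (h : RegularIntensity T Θ lam C D c)
    {v : EuclideanSpace ℝ (Fin d) → EuclideanSpace ℝ (Fin d)} (hv : ContinuousOn v Θ) :
    ContinuousOn (fun θ => invFisher T lam θ (v θ)) Θ := by
  have h1 : Continuous fun p : Matrix (Fin d) (Fin d) ℝ × EuclideanSpace ℝ (Fin d) =>
      WithLp.toLp 2 (p.1.mulVec p.2.ofLp) :=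
    (PiLp.continuous_toLp 2 _).comp
      (continuous_fst.matrix_mulVec ((PiLp.continuous_ofLp 2 _).comp continuous_snd))
  have h2 := h1.comp_continuousOn (h.continuousOn_inv_fisherInfo.prodMk hv)
  refine h2.congr fun θ _ => ?_
  simp only [invFisher, LinearMap.coe_toContinuousLinearMap', Matrix.toLpLin_apply,
    Function.comp_apply]

end RegularIntensity

/-! ### The influence function: bias, continuity, covariance -/

/-- The influence function `I(ϑ)⁻¹ λ̇(ϑ, t) / λ(ϑ, t)` of the one-step estimator, extended by `0`
outside of `Θ × T`. -/
noncomputable def influence {d : ℕ} (T : Set ℝ) (Θ : Set (EuclideanSpace ℝ (Fin d)))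
    (lam : EuclideanSpace ℝ (Fin d) → ℝ → ℝ) :
    EuclideanSpace ℝ (Fin d) → ℝ → EuclideanSpace ℝ (Fin d) :=
  Θ.indicator fun θ => T.indicator fun t => invFisher T lam θ (logGrad lam θ t)

/-- The integral of the influence function at `θ` against the intensity at `θ`. -/
noncomputable def compensator {d : ℕ} (T : Set ℝ) (Θ : Set (EuclideanSpace ℝ (Fin d)))
    (lam : EuclideanSpace ℝ (Fin d) → ℝ → ℝ) (θ : EuclideanSpace ℝ (Fin d)) :
    EuclideanSpace ℝ (Fin d) :=
  ∫ t, Θ.indicator (fun θ => T.indicator fun t => lam θ t • invFisher T lam θ (logGrad lam θ t)) θ t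

namespace RegularIntensity

variable {d : ℕ} {T : Set ℝ} {Θ : Set (EuclideanSpace ℝ (Fin d))}
  {lam : EuclideanSpace ℝ (Fin d) → ℝ → ℝ} {C D c : ℝ} {θ η : EuclideanSpace ℝ (Fin d)} {t : ℝ}

lemma influence_apply (hθ : θ ∈ Θ) (ht : t ∈ T) :
    influence T Θ lam θ t = invFisher T lam θ (logGrad lam θ t) := by
  simp [influence, hθ, ht]

lemma norm_influence_le (h : RegularIntensity T Θ lam C D c) (θ : EuclideanSpace ℝ (Fin d))
    (t : ℝ) : ‖influence T Θ lam θ t‖ ≤ c⁻¹ * C := by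
  have h1 := h.c_pos
  have h2 := h.nonneg
  have h0 : 0 ≤ c⁻¹ * C := by positivity
  by_cases hθ : θ ∈ Θ
  · by_cases ht : t ∈ T
    · rw [influence_apply hθ ht]
      refine (h.norm_invFisher_le hθ _).trans ?_
      gcongr
      exact h.norm_logGrad_le hθ ht
    · simpa [influence, hθ, ht] using h0
  · simpa [influence, hθ] using h0

lemma measurable_influence (h : RegularIntensity T Θ lam C D c) :
    Measurable (Function.uncurry (influence T Θ lam)) :=
  measurable_uncurry_indicator_of_continuousOn h.isOpen.measurableSet
    (fun _ ht => h.continuousOn_invFisher_apply (h.continuousOn_logGrad ht))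
    fun θ hθ => h.measurable_indicator_comp hθ (invFisher T lam θ).continuous

lemma measurable_compensator (h : RegularIntensity T Θ lam C D c) :
    Measurable (compensator T Θ lam) := by
  refine measurable_integral_param volume (measurable_uncurry_indicator_of_continuousOn
    h.isOpen.measurableSet (fun t ht => (h.continuousOn_intensity ht).smul
      (h.continuousOn_invFisher_apply (h.continuousOn_logGrad ht))) fun θ hθ => ?_)
  have h1 := (h.measurable θ hθ).smul
    (h.measurable_indicator_comp hθ (invFisher T lam θ).continuous)
  convert h1 using 1
  ext1 t
  by_cases ht : t ∈ T <;> simp [ht]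

lemma compensator_eq (h : RegularIntensity T Θ lam C D c) (hθ : θ ∈ Θ) :
    compensator T Θ lam θ =
      invFisher T lam θ (∫ t in T, lam θ t • logGrad lam θ t) := by
  rw [compensator, ← ContinuousLinearMap.integral_comp_comm _ (h.integrableOn_logGrad hθ hθ),
    ← integral_indicator h.measurableSet, indicator_of_mem hθ]
  simp only [map_smul]

lemma integral_influence (h : RegularIntensity T Θ lam C D c) (hθ : θ ∈ Θ) (x : Measure ℝ)
    [IsFiniteMeasure x] : ∫ t, influence T Θ lam θ t ∂x =
      invFisher T lam θ (∫ t in T, logGrad lam θ t ∂x) := by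
  have hi : Integrable (logGrad lam θ) (x.restrict T) :=
    Integrable.of_bound (aestronglyMeasurable_of_measurable_indicator h.measurableSet
      (h.measurable_indicator_logGrad hθ) x) C
      ((ae_restrict_mem h.measurableSet).mono fun t ht => h.norm_logGrad_le hθ ht)
  rw [← ContinuousLinearMap.integral_comp_comm _ hi, ← integral_indicator h.measurableSet,
    influence, indicator_of_mem hθ]

lemma integral_influence_intensityMeasure (h : RegularIntensity T Θ lam C D c) (hθ : θ ∈ Θ)
    (hη : η ∈ Θ) : ∫ t, influence T Θ lam θ t ∂(intensityMeasure T (lam η)) =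
      invFisher T lam θ (∫ t in T, lam η t • logGrad lam θ t) := by
  rw [integral_intensityMeasure h.measurableSet (h.measurable η hη)
    fun t ht => (h.pos η hη t ht).le,
    ← ContinuousLinearMap.integral_comp_comm _ (h.integrableOn_logGrad hη hθ)]
  refine setIntegral_congr_fun h.measurableSet fun t ht => ?_
  simp only [influence_apply hθ ht, map_smul]

/-- The one-step correction removes the bias up to the second order. -/
lemma norm_bias_le (h : RegularIntensity T Θ lam C D c) (hθ : θ ∈ Θ) (hη : η ∈ Θ) :
    ‖∫ t, influence T Θ lam θ t ∂(intensityMeasure T (lam η)) - compensator T Θ lam θ -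
      (η - θ)‖ ≤ c⁻¹ * (Real.exp (C * D) * (C ^ 2 * Real.exp (C * D) + C) * C *
        ∫ t in T, lam η t) * ‖θ - η‖ ^ 2 := by
  set K := Real.exp (C * D) * (C ^ 2 * Real.exp (C * D) + C) with hK
  have hc := h.c_pos
  have hC := h.nonneg
  have i1 := h.integrableOn_logGrad hη hθ
  have i2 := h.integrableOn_logGrad hθ hθ
  have i3 := h.integrableOn_inner_smul_logGrad hθ (η - θ)
  have i12 : IntegrableOn (fun t => lam η t • logGrad lam θ t - lam θ t • logGrad lam θ t) T :=
    i1.sub i2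
  -- The subtracted linear term integrates to `I(θ)(η - θ)`, which the inverse information maps to
  -- exactly `η - θ`.
  have e : ∫ t, influence T Θ lam θ t ∂(intensityMeasure T (lam η)) - compensator T Θ lam θ -
      (η - θ) = invFisher T lam θ (∫ t in T, (lam η t • logGrad lam θ t -
        lam θ t • logGrad lam θ t -
          lam θ t • (inner ℝ (logGrad lam θ t) (η - θ) : ℝ) • logGrad lam θ t)) := by
    rw [integral_sub i12 i3, integral_sub i1 i2, map_sub, map_sub,
      ← h.toEuclideanLin_fisherInfo hθ, h.invFisher_fisherInfo hθ,
      h.integral_influence_intensityMeasure hθ hη, h.compensator_eq hθ]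
  rw [e]
  calc ‖invFisher T lam θ (∫ t in T, (lam η t • logGrad lam θ t - lam θ t • logGrad lam θ t -
          lam θ t • (inner ℝ (logGrad lam θ t) (η - θ) : ℝ) • logGrad lam θ t))‖
      ≤ c⁻¹ * (∫ t in T, K * ‖θ - η‖ ^ 2 * C * lam η t) := by
        refine (h.norm_invFisher_le hθ _).trans ?_
        gcongr
        refine norm_integral_le_of_norm_le ((h.integrableOn η hη).const_mul _) ?_
        filter_upwards [ae_restrict_mem h.measurableSet] with t ht
        rw [smul_smul, ← sub_smul, ← sub_smul, norm_smul, Real.norm_eq_abs]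
        calc |lam η t - lam θ t - lam θ t * inner ℝ (logGrad lam θ t) (η - θ)| *
              ‖logGrad lam θ t‖ ≤ (K * ‖θ - η‖ ^ 2 * lam η t) * C := by
              have := h.pos η hη t ht
              gcongr
              · exact h.abs_intensity_sub_sub_le hθ hη ht
              · exact h.norm_logGrad_le hθ ht
          _ = K * ‖θ - η‖ ^ 2 * C * lam η t := by ring
    _ = c⁻¹ * (K * C * ∫ t in T, lam η t) * ‖θ - η‖ ^ 2 := by
        rw [integral_const_mul]
        ring

/-- The influence function is continuous in the parameter near `η`, because `Θ` is open, and
uniformly bounded, so dominated convergence applies under the finite intensity measure. -/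
lemma tendsto_integral_influence_sub (h : RegularIntensity T Θ lam C D c) (hη : η ∈ Θ) :
    Tendsto (fun θ => ∫ t, ‖influence T Θ lam θ t - influence T Θ lam η t‖ ^ 2
      ∂(intensityMeasure T (lam η))) (𝓝 η) (𝓝 0) := by
  have := isFiniteMeasure_intensityMeasure (h.integrableOn η hη)
  have hm (θ : EuclideanSpace ℝ (Fin d)) : Measurable (influence T Θ lam θ) :=
    h.measurable_influence.comp measurable_prodMk_left
  rw [show (0 : ℝ) = ∫ _, (0 : ℝ) ∂(intensityMeasure T (lam η)) by simp]
  refine tendsto_integral_filter_of_dominated_convergence (fun _ => (2 * (c⁻¹ * C)) ^ 2)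
    (Eventually.of_forall fun θ => (((hm θ).sub (hm η)).norm.pow_const 2).aestronglyMeasurable)
    (Eventually.of_forall fun θ => ae_of_all _ fun t => ?_) (integrable_const _)
    (ae_of_all _ fun t => ?_)
  · rw [norm_pow, norm_norm]
    gcongr
    refine (norm_sub_le _ _).trans ?_
    linarith [h.norm_influence_le θ t, h.norm_influence_le η t]
  · have hcont : ContinuousAt (fun θ => influence T Θ lam θ t) η := by
      by_cases ht : t ∈ T
      · have h1 := (h.continuousOn_invFisher_apply (h.continuousOn_logGrad ht)).continuousAt
          (h.isOpen.mem_nhds hη)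
        refine h1.congr ?_
        filter_upwards [h.isOpen.mem_nhds hη] with θ hθ
        exact (influence_apply hθ ht).symm
      · have h0 : (fun θ => influence T Θ lam θ t) = fun _ => 0 := by
          ext1 θ
          by_cases hθ : θ ∈ Θ <;> simp [influence, hθ, ht]
        rw [h0]
        exact continuousAt_const
    have h2 := ((hcont.tendsto.sub_const (influence T Θ lam η t)).norm.pow 2)
    simpa using h2

/-- With `w = I⁻¹ u`, symmetry gives `⟨u, I⁻¹ u⟩ = ⟨w, I w⟩`, the integral of `⟨w, λ̇/λ⟩² = ⟨u, I⁻¹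
λ̇/λ⟩²`. So the influence function has covariance `I⁻¹`. -/
lemma dotProduct_inv_fisherInfo (h : RegularIntensity T Θ lam C D c) (hθ : θ ∈ Θ)
    (u : EuclideanSpace ℝ (Fin d)) :
    u.ofLp ⬝ᵥ ((fisherInfo T lam θ)⁻¹).mulVec u.ofLp =
      ∫ t, inner ℝ u (influence T Θ lam θ t) ^ 2 ∂(intensityMeasure T (lam θ)) := by
  have h1 := h.inner_fisherInfo hθ (invFisher T lam θ u) (invFisher T lam θ u)
  rw [h.fisherInfo_invFisher hθ, ← h.inner_invFisher_comm hθ] at h1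
  have h2 : inner ℝ u (invFisher T lam θ u) =
      u.ofLp ⬝ᵥ ((fisherInfo T lam θ)⁻¹).mulVec u.ofLp := by
    rw [EuclideanSpace.inner_eq_star_dotProduct, dotProduct_comm]
    simp [invFisher, Matrix.toLpLin_apply]
  rw [← h2, h1, integral_intensityMeasure h.measurableSet (h.measurable θ hθ)
    fun t ht => (h.pos θ hθ t ht).le]
  refine setIntegral_congr_fun h.measurableSet fun t ht => ?_
  simp only [influence_apply hθ ht, h.inner_invFisher_comm hθ, smul_eq_mul, sq,
    real_inner_comm (logGrad lam θ t)]

/-- The one-step correction written as a sum of integrals of the influence function. -/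
lemma invFisher_sum_score (h : RegularIntensity T Θ lam C D c) (hθ : θ ∈ Θ) {x : ℕ → Measure ℝ}
    (hx : ∀ j, finitePart (x j) = x j) (S : Finset ℕ) :
    Matrix.toEuclideanLin (fisherInfo T lam θ)⁻¹ (∑ j ∈ S, score T lam θ (x j)) =
      ∑ j ∈ S, (∫ t, influence T Θ lam θ t ∂(finitePart (x j)) - compensator T Θ lam θ) := by
  change invFisher T lam θ _ = _
  rw [map_sum]
  refine Finset.sum_congr rfl fun j _ => ?_
  rw [h.integral_influence hθ, h.compensator_eq hθ, hx j, score, map_sub]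
  rfl

end RegularIntensity

end Auxiliary

/-! ### The one-step MLE -/

theorem theorem2 {Ω : Type*} [MeasurableSpace Ω] (P : Measure Ω) [IsProbabilityMeasure P]
    {d : ℕ} (T : Set ℝ) (hT : T.OrdConnected)
    (Θ : Set (EuclideanSpace ℝ (Fin d))) (hΘ_open : IsOpen Θ) (hΘ_convex : Convex ℝ Θ)
    (hΘ_bdd : Bornology.IsBounded Θ)
    (lam : EuclideanSpace ℝ (Fin d) → ℝ → ℝ)
    (hlam_meas : ∀ θ ∈ Θ, Measurable (lam θ))
    (hlam_int : ∀ θ ∈ Θ, IntegrableOn (lam θ) T)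
    (θ₀ : EuclideanSpace ℝ (Fin d)) (hθ₀ : θ₀ ∈ Θ)
    (X : ℕ → Ω → Measure ℝ)
    (hX : ∀ j, IsPoissonProcess P T (lam θ₀) (X j))
    (hX_indep : iIndepFun X P)
    (est : (n : ℕ) → (Fin n → Measure ℝ) → EuclideanSpace ℝ (Fin d))
    (hest : ∀ n, Measurable (est n))
    (δ : ℝ) (hδ : δ ∈ Ioo (1 / 2 : ℝ) 1)
    (hP0 : ConditionP0 P θ₀ X est)
    (hL0 : ConditionL0 T Θ lam) :
    TendstoInDistribution
      (fun (n : ℕ) ω => √(n : ℝ) • (oneStepMLE T Θ lam δ est n (fun j => X j ω) - θ₀))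
      atTop id (fun _ => P) (multivariateGaussian 0 (fisherInfo T lam θ₀)⁻¹) := by
  have hTm : MeasurableSet T := hT.measurableSet
  obtain ⟨C, hC⟩ := hL0.bounded
  obtain ⟨c, hc, hnd⟩ := hL0.nondegenerate
  obtain ⟨D, hD⟩ := Metric.isBounded_iff.1 hΘ_bdd
  -- The given bound comes without a sign; the maximum with `0` makes it nonnegative.
  have h : RegularIntensity T Θ lam (max C 0) D c :=
    { measurableSet := hTm
      isOpen := hΘ_open
      convex := hΘ_convex
      dist_le := fun θ hθ η hη => by
        rw [← dist_eq_norm]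
        exact hD hθ hη
      measurable := hlam_meas
      integrableOn := hlam_int
      pos := hL0.pos
      contDiffOn := hL0.contDiffOn
      nonneg := le_max_right _ _
      bounded := fun k hk θ hθ t ht => (hC k hk θ hθ t ht).trans (le_max_left _ _)
      c_pos := hc
      nondegenerate := hnd }
  have hpos : ∀ t ∈ T, 0 ≤ lam θ₀ t := fun t ht => (h.pos θ₀ hθ₀ t ht).le
  have hint : IntegrableOn (lam θ₀) T := hlam_int θ₀ hθ₀
  have hfin : ∀ᵐ ω ∂P, ∀ j, finitePart (X j ω) = X j ω :=
    ae_all_iff.2 fun j => (hX j).ae_finitePart hTm hint hpos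
  have hUm (n : ℕ) : Measurable fun ω => evalFirst est n fun j => X j ω :=
    measurable_evalFirst (fun j => (hX j).measurable) hest n
  refine tendstoInDistribution_oneStep hX hX_indep hTm hint hpos hΘ_open hθ₀
    h.measurable_influence h.norm_influence_le (c := compensator T Θ lam) ?_
    (fun θ hθ => h.norm_bias_le hθ hθ₀) (h.tendsto_integral_influence_sub hθ₀) hest hδ hP0
    (h.posDef_fisherInfo hθ₀).posSemidef.inv (h.dotProduct_inv_fisherInfo hθ₀)
    (fun n => ?_) fun n => ?_
  · have h0 := h.nonneg
    have h1 : 0 ≤ ∫ t in T, lam θ₀ t := setIntegral_nonneg hTm hpos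
    positivity
  · classical
    set N := learningSize δ n
    set U : Ω → EuclideanSpace ℝ (Fin d) := fun ω => evalFirst est N fun j => X j ω with hU
    have h1 (j : ℕ) : Measurable fun ω => ∫ t, influence T Θ lam (U ω) t ∂(finitePart (X j ω)) -
        compensator T Θ lam (U ω) :=
      ((measurable_integral_finitePart_prod h.measurable_influence).comp
        ((hUm N).prodMk (hX j).measurable)).sub (h.measurable_compensator.comp (hUm N))
    have h2 : Measurable fun ω => (n : ℝ)⁻¹ • ∑ j ∈ Finset.Ico N n,
        (∫ t, influence T Θ lam (U ω) t ∂(finitePart (X j ω)) - compensator T Θ lam (U ω)) :=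
      (Finset.measurable_fun_sum (Finset.Ico N n) fun j _ => h1 j).const_smul (n : ℝ)⁻¹
    have hset : MeasurableSet {ω | U ω ∈ Θ} := hUm N hΘ_open.measurableSet
    -- The score integrates against the raw observation; almost surely all observations are finite,
    -- and there the estimator equals this version, whose measurability is available.
    have hm : Measurable fun ω => if U ω ∈ Θ then U ω + (n : ℝ)⁻¹ • ∑ j ∈ Finset.Ico N n,
        (∫ t, influence T Θ lam (U ω) t ∂(finitePart (X j ω)) - compensator T Θ lam (U ω))
        else U ω :=
      Measurable.ite hset ((hUm N).add h2) (hUm N)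
    refine ⟨_, hm, ?_⟩
    filter_upwards [hfin] with ω hω
    change (if U ω ∈ Θ then _ else _) = _
    by_cases hmem : U ω ∈ Θ
    · rw [if_pos hmem, if_pos hmem, h.invFisher_sum_score hmem hω]
    · rw [if_neg hmem, if_neg hmem]
  · filter_upwards [hfin] with ω hω hmem
    rw [oneStepMLE]
    simp only [if_pos hmem]
    rw [h.invFisher_sum_score hmem hω]
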